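/- Let $d\ge 2$, let $E_d$ be the set of nearest-neighbour edges of $\mathbb Z^d$, let $\Omega=[0,\infty)^{E_d}$ carry the product Borel $\sigma$-algebra, and for $z\in\mathbb Z^d$ let $\tau_z:\Omega\to\Omega$ be the shift $(\tau_z\omega)(\{x,y\})=\omega(\{x+z,y+z\})$. For $\omega\in\Omega$ let $\mathcal O(\omega)=\{e\in E_d:\omega(e)>0\}$ be the set of open edges, write $x\sim y$ if $\{x,y\}\in\mathcal O(\omega)$, and let $\mathcal C_\infty(\omega)$ be the set of vertices in infinite connected components of $(\mathbb Z^d,\mathcal O(\omega))$. Let $d^\omega$ be the graph distance along open edges, $B^\omega(x,r)=\{y\in\mathcal C_\infty(\omega): d^\omega(x,y)\le\lfloor r\rfloor\}$ and $B^\omega(n)=B^\omega(0,n)$. Let $\mathbb P$ be a probability measure on $\Omega$ that is stationary and ergodic with respect to the shifts, with $\mathbb E[\omega(e)]<\infty$ for all $e\in E_d$, such that $\mathcal C_\infty(\omega)$ is (non-empty and) connected for $\mathbb P$-a.e. $\omega$ and $\mathbb P[0\in\mathcal C_\infty]>0$. Put $\mathbb P_0=\mathbb P[\,\cdot\mid 0\in\mathcal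 C_\infty]$, with expectation $\mathbb E_0$. *Corrector.* $L^2_{\mathrm{cov}}$ is the space of measurable $\Psi:\Omega\times\mathbb Z^d\to\mathbb R$ such that for $\mathbb P_0$-a.e. $\omega$, $\Psi(\tau_x\omega,y-x)=\Psi(\omega,y)-\Psi(\omega,x)$ for all $x,y\in\mathcal C_\infty(\omega)$, and $\|\Psi\|_{L^2_{\mathrm{cov}}}^2=\mathbb E_0\big[\sum_{x\sim 0}\omega(\{0,x\})|\Psi(\omega,x)|^2\big]<\infty$. $L^2_{\mathrm{pot}}$ is the closure in $L^2_{\mathrm{cov}}$ of the gradients $\mathrm D\varphi(\omega,x)=\varphi(\tau_x\omega)-\varphi(\omega)$ of bounded measurable functions $\varphi:\Omega\to\mathbb R$ that depend on finitely many edges only, and $L^2_{\mathrm{sol}}$ is its orthogonal complement in $L^2_{\mathrm{cov}}$. The $j$-th component $\chi_j$ of the corrector is the $L^2_{\mathrm{pot}}$-part of $\Pi_j(\omega,x)=x_j$ in the decomposition $L^2_{\mathrm{cov}}=L^2_{\mathrm{pot}}\oplus L^2_{\mathrm{sol}}$. *Regular balls.* Fix constants $C_{\mathrm V}\in(0,1]$,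 $C_{\mathrm{riso}}\in(0,\infty)$, $C_{\mathrm W}\in[1,\infty)$. For $x\in\mathcal C_\infty(\omega)$ and an integer $r\ge1$, the ball $B^\omega(x,r)$ is called regular if $|B^\omega(x,r)|\ge C_{\mathrm V}r^d$ and there is a connected set $\mathcal S\subset\mathcal C_\infty(\omega)$ with $B^\omega(x,r)\subset\mathcal S\subset B^\omega(x,C_{\mathrm W}r)$ such that for every $A\subset\mathcal S$ with $|A|\le\frac12|\mathcal S|$ the number of open edges $\{y,z\}$ with $y\in A$, $z\in\mathcal S\setminus A$ is at least $C_{\mathrm{riso}}\,r^{-1}|A|$. **Proposition ($\ell^1$-sublinearity).** Let $\theta\in(0,1)$ and suppose that for $\mathbb P_0$-a.e. $\omega$ there is $N_0(\omega)<\infty$ such that for all $n\ge N_0(\omega)$ the ball $B^\omega(n)$ is $\theta$-very regular, i.e. $B^\omega(x,r)$ is regular for every $x\in B^\omega(n)$ and every integer $r\ge1$ with $r\ge n^{\theta/d}$. Suppose further that $\mathbb E\big[\omega(e)^{-1}\mathbf 1_{\{e\in\mathcal O\}}\big]<\infty$ for all $e\in E_d$. Then, for every $j=1,\dots,d$, the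 corrector component $\chi_j$ exists, and every version of it satisfies $$\lim_{n\to\infty}\frac1{|B^\omega(n)|}\sum_{x\in B^\omega(n)}\Big|\frac1n\,\chi_j(\omega,x)\Big|=0\qquad\text{for }\mathbb P_0\text{-a.e. }\omega .$$ -/

import Mathlib

open MeasureTheory ProbabilityTheory Filter
open scoped NNReal ENNReal Topology

namespace RandomConductance

/-- The Euclidean lattice `(ℤ^d, E_d)`: `x` and `y` are joined by an edge iff `|x - y|₁ = 1`. -/
def latticeGraph (d : ℕ) : SimpleGraph (Fin d → ℤ) where
  Adj x y := ∑ i, |x i - y i| = 1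
  symm := ⟨fun x y h => by simpa only [abs_sub_comm] using h⟩
  loopless := ⟨fun x h => by simp at h⟩

/-- The edge set `E_d` of non-oriented nearest-neighbour bonds. -/
abbrev Edge (d : ℕ) : Type := (latticeGraph d).edgeSet

/-- The space of environments `Ω = [0, ∞)^{E_d}`; its σ-algebra is the product Borel σ-algebra. -/
abbrev Env (d : ℕ) : Type := Edge d → ℝ≥0

variable {d : ℕ}

theorem latticeGraph_adj_add {x y : Fin d → ℤ} (z : Fin d → ℤ)
    (h : (latticeGraph d).Adj x y) : (latticeGraph d).Adj (x + z) (y + z) := by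
  simpa [latticeGraph] using h

/-- The edge `{x + z, y + z}` for `e = {x, y}`. -/
def shiftEdge (z : Fin d → ℤ) (e : Edge d) : Edge d :=
  ⟨Sym2.map (fun x => x + z) e.1, by
    obtain ⟨e, he⟩ := e
    induction e using Sym2.ind with
    | _ x y => exact latticeGraph_adj_add z he⟩

/-- The space shift `(τ_z ω)({x, y}) = ω({x + z, y + z})`. -/
def shift (z : Fin d → ℤ) (ω : Env d) : Env d := fun e => ω (shiftEdge z e)

open Classical in
/-- `ω({x, y})` if `{x, y}` is an edge of the lattice, and `0` otherwise. -/
noncomputable def conductance (ω : Env d) (x y : Fin d → ℤ) : ℝ≥0 :=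
  if h : (latticeGraph d).Adj x y then ω ⟨s(x, y), h⟩ else 0

theorem conductance_comm (ω : Env d) (x y : Fin d → ℤ) :
    conductance ω x y = conductance ω y x := by
  unfold conductance
  by_cases h : (latticeGraph d).Adj x y
  · rw [dif_pos h, dif_pos h.symm]
    congr 2
    exact Sym2.eq_swap
  · rw [dif_neg h, dif_neg (fun h' => h h'.symm)]

/-- The graph `(ℤ^d, 𝒪(ω))` of open edges, i.e. of edges with positive conductance. -/
def openGraph (ω : Env d) : SimpleGraph (Fin d → ℤ) where
  Adj x y := 0 < conductance ω x y
  symm := ⟨fun x y h => by rwa [conductance_comm]⟩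
  loopless := ⟨fun x h => by simp [conductance] at h⟩

/-- `𝒞_∞(ω)`: the set of vertices that lie in infinite connected components of `(ℤ^d, 𝒪(ω))`. -/
def cluster (ω : Env d) : Set (Fin d → ℤ) :=
  {x | {y | (openGraph ω).Reachable x y}.Infinite}

/-- `B^ω(x, r) = {y ∈ 𝒞_∞(ω) : d^ω(x, y) ≤ ⌊r⌋}`.  A path of open edges that starts in `𝒞_∞(ω)`
stays there, so the graph distance may be taken in `(ℤ^d, 𝒪(ω))`
(it is `⊤` between different components). -/
noncomputable def ball (ω : Env d) (x : Fin d → ℤ) (r : ℝ) : Set (Fin d → ℤ) :=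
  {y | y ∈ cluster ω ∧ (openGraph ω).edist x y ≤ (⌊r⌋₊ : ℕ∞)}

theorem latticeGraph_adj_of_openGraph_adj {ω : Env d} {x y : Fin d → ℤ}
    (h : (openGraph ω).Adj x y) : (latticeGraph d).Adj x y := by
  by_contra h'
  simp [openGraph, conductance, h'] at h

theorem sum_abs_sub_le_length {ω : Env d} {x y : Fin d → ℤ} (p : (openGraph ω).Walk x y) :
    ∑ i, |x i - y i| ≤ (p.length : ℤ) := by
  induction p with
  | nil => simp
  | @cons u v w h p ih =>
    have h1 : ∑ i, |u i - v i| = 1 := latticeGraph_adj_of_openGraph_adj h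
    have h2 : ∑ i, |u i - w i| ≤ ∑ i, |u i - v i| + ∑ i, |v i - w i| := by
      rw [← Finset.sum_add_distrib]
      exact Finset.sum_le_sum fun i _ => abs_sub_le _ _ _
    rw [SimpleGraph.Walk.length_cons]
    push_cast
    linarith

theorem finite_ball (ω : Env d) (x : Fin d → ℤ) (r : ℝ) : (ball ω x r).Finite := by
  refine (Set.finite_Icc (x - fun _ => (⌊r⌋₊ : ℤ)) (x + fun _ => (⌊r⌋₊ : ℤ))).subset ?_
  rintro y ⟨-, hy⟩
  have hne : (openGraph ω).edist x y ≠ ⊤ := ne_top_of_le_ne_top (by simp) hy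
  obtain ⟨p, hp⟩ := SimpleGraph.exists_walk_of_edist_ne_top hne
  rw [← hp] at hy
  have hl : p.length ≤ ⌊r⌋₊ := by exact_mod_cast hy
  have key : ∀ i, |x i - y i| ≤ (⌊r⌋₊ : ℤ) := fun i =>
    ((Finset.single_le_sum (f := fun i => |x i - y i|) (fun j _ => abs_nonneg _)
      (Finset.mem_univ i)).trans (sum_abs_sub_le_length p)).trans (by exact_mod_cast hl)
  constructor <;> intro i <;> have := abs_le.1 (key i) <;>
    simp only [Pi.sub_apply, Pi.add_apply] <;> linarith

/-- The relative boundary `∂_S^ω A = {{x, y} ∈ 𝒪(ω) : x ∈ A and y ∈ S \ A}`. -/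
def relBoundary (ω : Env d) (S A : Set (Fin d → ℤ)) : Set (Sym2 (Fin d → ℤ)) :=
  {e | ∃ x ∈ A, ∃ y ∈ S \ A, (openGraph ω).Adj x y ∧ e = s(x, y)}

/-- Regularity of the ball `B^ω(x, n)` with constants `CV`, `Criso`, `CW`: volume regularity of
order `d` and the weak relative isoperimetric inequality. -/
def IsRegularBall (CV Criso CW : ℝ) (ω : Env d) (x : Fin d → ℤ) (n : ℕ) : Prop :=
  CV * (n : ℝ) ^ d ≤ ((ball ω x n).ncard : ℝ) ∧
  ∃ S : Set (Fin d → ℤ), S ⊆ cluster ω ∧ ((openGraph ω).induce S).Connected ∧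
    ball ω x n ⊆ S ∧ S ⊆ ball ω x (CW * n) ∧
    ∀ A : Set (Fin d → ℤ), A ⊆ S → (A.ncard : ℝ) ≤ 1 / 2 * (S.ncard : ℝ) →
      Criso * (n : ℝ)⁻¹ * (A.ncard : ℝ) ≤ ((relBoundary ω S A).ncard : ℝ)

/-- The ball `B^ω(0, n)` is `θ`-very regular. -/
def IsVeryRegularBall (CV Criso CW θ : ℝ) (ω : Env d) (n : ℕ) : Prop :=
  ∀ x ∈ ball ω 0 n, ∀ r : ℕ, 1 ≤ r → (n : ℝ) ^ (θ / d) ≤ (r : ℝ) →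
    IsRegularBall CV Criso CW ω x r

/-- The standing assumptions on the law `P` of the conductances: stationarity, ergodicity,
integrability, and existence and uniqueness of the infinite cluster, which contains the origin
with positive probability. -/
structure IsAdmissibleLaw (P : Measure (Env d)) : Prop where
  stationary : ∀ z : Fin d → ℤ, MeasurePreserving (shift z) P P
  ergodic : ∀ s : Set (Env d), MeasurableSet s → (∀ z : Fin d → ℤ, shift z ⁻¹' s = s) →
    P s = 0 ∨ P s = 1
  integrable : ∀ e : Edge d, ∫⁻ ω, (ω e : ℝ≥0∞) ∂P < ∞
  connected : ∀ᵐ ω ∂P, ((openGraph ω).induce (cluster ω)).Connected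
  pos : 0 < P {ω | 0 ∈ cluster ω}

/-- The conditional law `P₀ = P[ · | 0 ∈ 𝒞_∞]`. -/
noncomputable def condLaw (P : Measure (Env d)) : Measure (Env d) :=
  ProbabilityTheory.cond P {ω | 0 ∈ cluster ω}

/-- The lattice neighbours of the origin. -/
noncomputable def unitSteps (d : ℕ) : Finset (Fin d → ℤ) :=
  (Finset.Icc (-1) 1).filter fun x => ∑ i, |x i| = 1

theorem mem_unitSteps {x : Fin d → ℤ} : x ∈ unitSteps d ↔ (latticeGraph d).Adj 0 x := by
  simp only [unitSteps, Finset.mem_filter, Finset.mem_Icc, latticeGraph, Pi.zero_apply, zero_sub,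
    abs_neg, and_iff_right_iff_imp]
  intro h
  have key : ∀ i, |x i| ≤ 1 := fun i => h ▸
    Finset.single_le_sum (f := fun i => |x i|) (fun j _ => abs_nonneg _) (Finset.mem_univ i)
  exact ⟨fun i => (abs_le.1 (key i)).1, fun i => (abs_le.1 (key i)).2⟩

/-- `‖Ψ‖²_{L²_cov} = E₀[∑_{x ∼ 0} ω({0, x}) |Ψ(ω, x)|²]`; closed edges contribute `0`. -/
noncomputable def covNormSq (P : Measure (Env d)) (Ψ : Env d → (Fin d → ℤ) → ℝ) : ℝ≥0∞ :=
  ∫⁻ ω, ∑ x ∈ unitSteps d, (conductance ω 0 x : ℝ≥0∞) * ‖Ψ ω x‖ₑ ^ 2 ∂(condLaw P)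

/-- The inner product `E₀[∑_{x ∼ 0} ω({0, x}) Ψ(ω, x) Φ(ω, x)]` of `L²_cov`. -/
noncomputable def covInner (P : Measure (Env d)) (Ψ Φ : Env d → (Fin d → ℤ) → ℝ) : ℝ :=
  ∫ ω, ∑ x ∈ unitSteps d, (conductance ω 0 x : ℝ) * (Ψ ω x * Φ ω x) ∂(condLaw P)

/-- `Ψ ∈ L²_cov`: a measurable random field with the cocycle property and finite norm. -/
structure MemLcov (P : Measure (Env d)) (Ψ : Env d → (Fin d → ℤ) → ℝ) : Prop where
  measurable : ∀ x, Measurable fun ω => Ψ ω x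
  cocycle : ∀ᵐ ω ∂(condLaw P), ∀ x ∈ cluster ω, ∀ y ∈ cluster ω,
    Ψ (shift x ω) (y - x) = Ψ ω y - Ψ ω x
  normSq_lt_top : covNormSq P Ψ < ∞

/-- The horizontal gradient `D φ (ω, x) = φ(τ_x ω) - φ(ω)`. -/
def grad (φ : Env d → ℝ) : Env d → (Fin d → ℤ) → ℝ := fun ω x => φ (shift x ω) - φ ω

/-- Bounded measurable functions on `Ω` that depend only on finitely many edges. -/
structure IsLocal (φ : Env d → ℝ) : Prop where
  measurable : Measurable φ
  bounded : ∃ C : ℝ, ∀ ω, |φ ω| ≤ C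
  dependsOn : ∃ F : Finset (Edge d), DependsOn φ (F : Set (Edge d))

/-- `Ψ ∈ L²_pot`: the closure in `L²_cov` of the gradients of local functions. -/
def MemLpot (P : Measure (Env d)) (Ψ : Env d → (Fin d → ℤ) → ℝ) : Prop :=
  MemLcov P Ψ ∧ ∀ ε : ℝ≥0∞, 0 < ε →
    ∃ φ : Env d → ℝ, IsLocal φ ∧ covNormSq P (fun ω x => Ψ ω x - grad φ ω x) < ε

/-- `Φ ∈ L²_sol`: the orthogonal complement of `L²_pot` in `L²_cov`. -/
def MemLsol (P : Measure (Env d)) (Φ : Env d → (Fin d → ℤ) → ℝ) : Prop :=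
  MemLcov P Φ ∧ ∀ Ψ, MemLpot P Ψ → covInner P Φ Ψ = 0

/-- `χ` is (a version of) the `j`-th component of the corrector: the `L²_pot`-part of the position
field `Π_j(ω, x) = x_j` in the orthogonal decomposition `L²_cov = L²_pot ⊕ L²_sol`. -/
def IsCorrector (P : Measure (Env d)) (j : Fin d) (χ : Env d → (Fin d → ℤ) → ℝ) : Prop :=
  MemLpot P χ ∧ MemLsol P (fun ω x => (x j : ℝ) - χ ω x)

end RandomConductance

namespace RandomConductance

variable {d : ℕ}

/-! ### Shifts, open edges and the infinite cluster -/

/-! Sublinearity. Since $\chi_j$ lies in $L^2_{\mathrm{pot}}$, it is approximated in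
$L^2_{\mathrm{cov}}$ by gradients of bounded local functions $\varphi_k$. Finiteness of $\mathbb
E[\omega(e)^{-1}\mathbf 1_{\{e\in\mathcal O\}}]$ turns this into an unweighted $L^1$ approximation
along open edges, with error at most $4^{-k}$ (`exists_isLocal_lintegral_localSum_le`). Wiener's
maximal inequality and Borel–Cantelli then make the spatial averages of this error at most $2^{-k}$
over all cubes centred at the origin simultaneously, for all large $k$
(`IsAdmissibleLaw.ae_eventually_sum_cube_le`); no ergodic theorem is needed for this.

By the co-area formula, the relative isoperimetric inequality gives an $\ell^1$-Poincaré inequality.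
Applied to $x\mapsto\chi(\omega,x)-\varphi_k(\tau_x\omega)$ near $B^\omega(n)$, it bounds the mean
oscillation there by $C\,2^{-k}n$. Since $\varphi_k$ is bounded, adding it back costs $O(1)$ per
vertex, so the mean oscillation of $\chi$ itself is $o(n)$. It remains to control the centring
constants $m_n$: the balls are volume doubling, so $|m_n-m_{n/2}|\le C\varepsilon n$, and summing
over dyadic scales gives $|m_n|\le M_0+C'\varepsilon n$ (`tendsto_average_of_oscillation`).

Existence. The corrector is an orthogonal projection in the $L^2$ space of fields on the edges at
the origin. The point needing proof is that a limit of gradients there, determined only on those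
edges, extends to a cocycle on the whole cluster. Stationarity transports almost sure convergence to
every open edge of the cluster, and connectedness propagates it along paths
(`exists_memLpot_ae_eq`). -/

theorem shift_shift (x y : Fin d → ℤ) (ω : Env d) : shift y (shift x ω) = shift (x + y) ω := by
  funext e
  obtain ⟨e, he⟩ := e
  induction e using Sym2.ind with
  | _ a b =>
    simp only [shift, shiftEdge, Sym2.map_mk, add_assoc, add_comm x y]

@[simp] theorem shift_zero (ω : Env d) : shift 0 ω = ω := by
  funext e
  obtain ⟨e, he⟩ := e
  induction e using Sym2.ind with
  | _ a b => simp [shift, shiftEdge]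

theorem measurable_shift (z : Fin d → ℤ) : Measurable (shift (d := d) z) :=
  measurable_pi_lambda _ fun _ => measurable_pi_apply _

theorem latticeGraph_adj_add_iff {x y : Fin d → ℤ} (z : Fin d → ℤ) :
    (latticeGraph d).Adj (x + z) (y + z) ↔ (latticeGraph d).Adj x y := by
  simp [latticeGraph]

theorem conductance_shift (z : Fin d → ℤ) (ω : Env d) (x y : Fin d → ℤ) :
    conductance (shift z ω) x y = conductance ω (x + z) (y + z) := by
  unfold conductance
  by_cases h : (latticeGraph d).Adj x y
  · rw [dif_pos h, dif_pos (latticeGraph_adj_add z h)]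
    rfl
  · rw [dif_neg h, dif_neg (fun h' => h ((latticeGraph_adj_add_iff z).1 h'))]

theorem measurable_conductance (x y : Fin d → ℤ) :
    Measurable fun ω : Env d => conductance ω x y := by
  unfold conductance
  by_cases h : (latticeGraph d).Adj x y
  · simpa only [dif_pos h] using measurable_pi_apply _
  · simp only [dif_neg h]; exact measurable_const

theorem openGraph_adj_shift {z : Fin d → ℤ} {ω : Env d} {x y : Fin d → ℤ} :
    (openGraph (shift z ω)).Adj x y ↔ (openGraph ω).Adj (x + z) (y + z) := by
  simp only [openGraph, conductance_shift]

theorem reachable_shift {z : Fin d → ℤ} {ω : Env d} {x y : Fin d → ℤ} :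
    (openGraph (shift z ω)).Reachable x y ↔ (openGraph ω).Reachable (x + z) (y + z) := by
  let φ : openGraph (shift z ω) ≃g openGraph ω :=
    ⟨Equiv.addRight z, fun {a b} => openGraph_adj_shift.symm⟩
  exact (SimpleGraph.Iso.reachable_iff (φ := φ) (u := x) (v := y)).symm

theorem mem_cluster_shift {z : Fin d → ℤ} {ω : Env d} {x : Fin d → ℤ} :
    x ∈ cluster (shift z ω) ↔ x + z ∈ cluster ω := by
  simp only [cluster, Set.mem_ofPred_eq, reachable_shift]
  have h : {y | (openGraph ω).Reachable (x + z) (y + z)} =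
      (Equiv.addRight z) ⁻¹' {y | (openGraph ω).Reachable (x + z) y} := rfl
  rw [h, ← Set.infinite_coe_iff, ← Set.infinite_coe_iff]
  exact (((Equiv.addRight z).subtypeEquiv (fun a => Iff.rfl) :
    _ ≃ {y // y ∈ {y | (openGraph ω).Reachable (x + z) y}})).infinite_iff

theorem sub_mem_unitSteps {ω : Env d} {x y : Fin d → ℤ} (h : (openGraph ω).Adj x y) :
    y - x ∈ unitSteps d := by
  rw [mem_unitSteps, ← latticeGraph_adj_add_iff x]
  simpa using latticeGraph_adj_of_openGraph_adj h

theorem measurableSet_adj (x y : Fin d → ℤ) : MeasurableSet {ω : Env d | (openGraph ω).Adj x y} :=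
  measurableSet_lt measurable_const (measurable_conductance x y)

theorem measurableSet_walk_length (n : ℕ) (x y : Fin d → ℤ) :
    MeasurableSet {ω : Env d | ∃ p : (openGraph ω).Walk x y, p.length = n} := by
  induction n generalizing x with
  | zero =>
    have : {ω : Env d | ∃ p : (openGraph ω).Walk x y, p.length = 0} = {_ω | x = y} := by
      ext ω
      exact ⟨fun ⟨p, hp⟩ => SimpleGraph.Walk.eq_of_length_eq_zero hp,
        fun h => by obtain rfl := h; exact ⟨.nil, rfl⟩⟩
    rw [this]
    exact MeasurableSet.const _
  | succ n ih =>
    have : {ω : Env d | ∃ p : (openGraph ω).Walk x y, p.length = n + 1} =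
        ⋃ z, {ω | (openGraph ω).Adj x z} ∩
          {ω | ∃ p : (openGraph ω).Walk z y, p.length = n} := by
      ext ω
      simp only [Set.mem_ofPred_eq, Set.mem_iUnion, Set.mem_inter_iff]
      constructor
      · rintro ⟨p, hp⟩
        cases p with
        | nil => simp at hp
        | cons h q => exact ⟨_, h, q, by simpa using hp⟩
      · rintro ⟨z, h, q, rfl⟩
        exact ⟨.cons h q, rfl⟩
    rw [this]
    exact MeasurableSet.iUnion fun z => (measurableSet_adj x z).inter (ih z)

theorem measurableSet_reachable (x y : Fin d → ℤ) :
    MeasurableSet {ω : Env d | (openGraph ω).Reachable x y} := by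
  have : {ω : Env d | (openGraph ω).Reachable x y} =
      ⋃ n, {ω | ∃ p : (openGraph ω).Walk x y, p.length = n} := by
    ext ω
    simp only [Set.mem_ofPred_eq, Set.mem_iUnion]
    exact ⟨fun ⟨p⟩ => ⟨_, p, rfl⟩, fun ⟨_, p, _⟩ => ⟨p⟩⟩
  rw [this]
  exact MeasurableSet.iUnion fun n => measurableSet_walk_length n x y

/-- A component is infinite iff no finite set contains it, and the lattice has only countably many
finite subsets. -/
theorem measurableSet_mem_cluster (x : Fin d → ℤ) :
    MeasurableSet {ω : Env d | x ∈ cluster ω} := by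
  have : {ω : Env d | x ∈ cluster ω} =
      ⋂ F : Finset (Fin d → ℤ), ⋃ y ∈ {y | y ∉ F}, {ω | (openGraph ω).Reachable x y} := by
    ext ω
    simp only [cluster, Set.mem_ofPred_eq, Set.mem_iInter, Set.mem_iUnion, exists_prop]
    constructor
    · intro h F
      obtain ⟨y, hy, hF⟩ := h.exists_notMem_finset F
      exact ⟨y, hF, hy⟩
    · intro h hfin
      obtain ⟨y, hF, hy⟩ := h hfin.toFinset
      exact hF (hfin.mem_toFinset.2 hy)
  rw [this]
  exact MeasurableSet.iInter fun F => MeasurableSet.biUnion (Set.to_countable _)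
    fun y _ => measurableSet_reachable x y

theorem abs_sub_le_of_mem_ball {ω : Env d} {x y : Fin d → ℤ} {r : ℝ} (h : y ∈ ball ω x r)
    (i : Fin d) : |x i - y i| ≤ (⌊r⌋₊ : ℤ) := by
  have hne : (openGraph ω).edist x y ≠ ⊤ := ne_top_of_le_ne_top (by simp) h.2
  obtain ⟨p, hp⟩ := SimpleGraph.exists_walk_of_edist_ne_top hne
  have hy := h.2
  rw [← hp] at hy
  have hl : p.length ≤ ⌊r⌋₊ := by exact_mod_cast hy
  exact ((Finset.single_le_sum (f := fun i => |x i - y i|) (fun j _ => abs_nonneg _)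
    (Finset.mem_univ i)).trans (sum_abs_sub_le_length p)).trans (by exact_mod_cast hl)

/-- The cube `x + [-n, n]^d`. -/
noncomputable def cube (x : Fin d → ℤ) (n : ℕ) : Finset (Fin d → ℤ) :=
  Finset.Icc (fun i => x i - n) (fun i => x i + n)

theorem mem_cube {x y : Fin d → ℤ} {n : ℕ} : y ∈ cube x n ↔ ∀ i, |y i - x i| ≤ n := by
  simp only [cube, Finset.mem_Icc, Pi.le_def, abs_le, ← forall_and]
  exact forall_congr' fun i => by constructor <;> rintro ⟨h, h'⟩ <;> constructor <;> linarith

theorem card_cube (x : Fin d → ℤ) (n : ℕ) : (cube x n).card = (2 * n + 1) ^ d := by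
  rw [cube, Pi.card_Icc]
  have : ∀ i ∈ Finset.univ, (Finset.Icc (x i - (n : ℤ)) (x i + n)).card = 2 * n + 1 := by
    intro i _
    rw [Int.card_Icc]; omega
  rw [Finset.prod_congr rfl this]
  simp

theorem mem_cube_of_mem_ball {ω : Env d} {x y : Fin d → ℤ} {r : ℝ} (h : y ∈ ball ω x r) :
    y ∈ cube x ⌊r⌋₊ :=
  mem_cube.2 fun i => by rw [abs_sub_comm]; exact abs_sub_le_of_mem_ball h i

theorem sum_cube_eq_sum_cube_zero {M : Type*} [AddCommMonoid M] (x : Fin d → ℤ) (n : ℕ)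
    (f : (Fin d → ℤ) → M) : ∑ y ∈ cube x n, f y = ∑ y ∈ cube 0 n, f (x + y) := by
  refine Finset.sum_bij' (fun y _ => y - x) (fun y _ => x + y) ?_ ?_ ?_ ?_ ?_ <;>
    simp [mem_cube]

/-! ### The conditional law -/

theorem ae_condLaw_iff {P : Measure (Env d)} [IsProbabilityMeasure P] {p : Env d → Prop} :
    (∀ᵐ ω ∂condLaw P, p ω) ↔ ∀ᵐ ω ∂P, 0 ∈ cluster ω → p ω := by
  rw [condLaw, ProbabilityTheory.cond,
    Measure.ae_ennreal_smul_measure_iff (by simp), ae_restrict_iff' (measurableSet_mem_cluster 0)]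
  rfl

theorem lintegral_condLaw (P : Measure (Env d)) (f : Env d → ℝ≥0∞) :
    ∫⁻ ω, f ω ∂condLaw P =
      (P {ω | 0 ∈ cluster ω})⁻¹ * ∫⁻ ω in {ω | 0 ∈ cluster ω}, f ω ∂P := by
  rw [condLaw, ProbabilityTheory.cond, lintegral_smul_measure, smul_eq_mul]

/-- A property of the environment that holds almost surely under `P₀` holds almost surely for
the environment seen from any point of the infinite cluster. -/
theorem IsAdmissibleLaw.ae_forall_cluster {P : Measure (Env d)} [IsProbabilityMeasure P]
    (hP : IsAdmissibleLaw P) {p : Env d → Prop} (h : ∀ᵐ ω ∂condLaw P, p ω) :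
    ∀ᵐ ω ∂P, ∀ x ∈ cluster ω, p (shift x ω) := by
  rw [ae_condLaw_iff] at h
  rw [ae_all_iff]
  intro x
  filter_upwards [(hP.stationary x).quasiMeasurePreserving.ae h] with ω hω hx
  exact hω (mem_cluster_shift.2 (by simpa using hx))

/-! ### A maximal inequality for the shifts -/

theorem coe_cube (x : Fin d → ℤ) (n : ℕ) :
    (cube x n : Set (Fin d → ℤ)) = Metric.closedBall x (n : ℝ) := by
  ext y
  rw [Finset.mem_coe, mem_cube, Metric.mem_closedBall, dist_pi_le_iff (Nat.cast_nonneg n)]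
  refine forall_congr' fun i => ?_
  rw [Int.dist_eq]
  exact_mod_cast Iff.rfl

/-- A covering estimate: if `g` has mean at least `c` over a cube centred at each point of `T`, then
the total mass of `g` over these cubes controls `c |T|`. -/
theorem mul_card_le_of_cube (g : (Fin d → ℤ) → ℝ≥0∞) (c : ℝ≥0∞) (T W : Finset (Fin d → ℤ))
    (n : (Fin d → ℤ) → ℕ) (hT : ∀ x ∈ T, c * (2 * n x + 1) ^ d ≤ ∑ y ∈ cube x (n x), g y)
    (hW : ∀ x ∈ T, cube x (n x) ⊆ W) :
    c * T.card ≤ 4 ^ d * ∑ y ∈ W, g y := by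
  classical
  -- In the sup metric cubes are closed balls. Vitali needs some common bound on the radii, here
  -- their sum, and an enlargement factor above 3; the integer 4 makes the enlarged balls cubes
  -- again.
  obtain ⟨u, huT, hdisj, hcov⟩ := Vitali.exists_disjoint_subfamily_covering_enlargement_closedBall
    (T : Set (Fin d → ℤ)) id (fun x => (n x : ℝ)) (∑ x ∈ T, (n x : ℝ))
    (fun a ha => Finset.single_le_sum (f := fun x => (n x : ℝ)) (fun i _ => Nat.cast_nonneg _) ha)
    4 (by norm_num)
  have hufin : u.Finite := T.finite_toSet.subset huT
  lift u to Finset (Fin d → ℤ) using hufin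
  have huT' : u ⊆ T := by exact_mod_cast huT
  have hTsub : T ⊆ u.biUnion fun b => cube b (4 * n b) := by
    intro a ha
    obtain ⟨b, hb, hab⟩ := hcov a ha
    rw [Finset.mem_biUnion]
    refine ⟨b, hb, ?_⟩
    have := hab (Metric.mem_closedBall_self (Nat.cast_nonneg _))
    rw [← Finset.mem_coe, coe_cube]
    simpa using this
  have hcard : (T.card : ℝ≥0∞) ≤ ∑ b ∈ u, 4 ^ d * (2 * (n b : ℝ≥0∞) + 1) ^ d := by
    have h1 : T.card ≤ ∑ b ∈ u, 4 ^ d * (2 * n b + 1) ^ d := by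
      refine (Finset.card_le_card hTsub).trans (Finset.card_biUnion_le.trans ?_)
      refine Finset.sum_le_sum fun b _ => ?_
      rw [card_cube, ← mul_pow]
      exact Nat.pow_le_pow_left (by omega) _
    exact_mod_cast h1
  calc c * T.card ≤ c * ∑ b ∈ u, 4 ^ d * (2 * (n b : ℝ≥0∞) + 1) ^ d := by gcongr
    _ = 4 ^ d * ∑ b ∈ u, c * (2 * (n b : ℝ≥0∞) + 1) ^ d := by
      rw [Finset.mul_sum, Finset.mul_sum]
      exact Finset.sum_congr rfl fun b _ => by ring
    _ ≤ 4 ^ d * ∑ b ∈ u, ∑ y ∈ cube b (n b), g y := by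
      gcongr with b hb
      exact hT b (huT' hb)
    _ = 4 ^ d * ∑ y ∈ u.biUnion fun b => cube b (n b), g y := by
      rw [Finset.sum_biUnion]
      intro a ha b hb hab
      have := hdisj ha hb hab
      simp only [Function.onFun, id, ← coe_cube] at this
      exact_mod_cast this
    _ ≤ 4 ^ d * ∑ y ∈ W, g y := by
      gcongr
      exact Finset.biUnion_subset.2 fun b hb => hW b (huT' hb)

theorem lintegral_comp_shift {P : Measure (Env d)} (hP : IsAdmissibleLaw P) {f : Env d → ℝ≥0∞}
    (hf : Measurable f) (x : Fin d → ℤ) : ∫⁻ ω, f (shift x ω) ∂P = ∫⁻ ω, f ω ∂P :=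
  (hP.stationary x).lintegral_comp hf

/-- Transference: the covering estimate is applied along the orbit, with `g y = f (shift y ω)` and
centres in $[-N,N]^d$, and then integrated using stationarity. Radii at most `N` keep all cubes
inside $[-2N,2N]^d$, so $4^d$ from the covering and $2^d$ from this larger cube give $8^d$. -/
theorem IsAdmissibleLaw.maximal_ineq_aux {P : Measure (Env d)} (hP : IsAdmissibleLaw P)
    {f : Env d → ℝ≥0∞} (hf : Measurable f) (c : ℝ≥0∞) (N : ℕ) :
    c * P {ω | ∃ n ≤ N, c * (2 * (n : ℝ≥0∞) + 1) ^ d ≤ ∑ y ∈ cube 0 n, f (shift y ω)} ≤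
      8 ^ d * ∫⁻ ω, f ω ∂P := by
  classical
  set E : Set (Env d) :=
    {ω | ∃ n ≤ N, c * (2 * (n : ℝ≥0∞) + 1) ^ d ≤ ∑ y ∈ cube 0 n, f (shift y ω)} with hE
  have hEm : MeasurableSet E := by
    have : E = ⋃ n ∈ {n | n ≤ N},
        {ω | c * (2 * (n : ℝ≥0∞) + 1) ^ d ≤ ∑ y ∈ cube 0 n, f (shift y ω)} := by
      ext ω; simp [hE]
    rw [this]
    exact MeasurableSet.biUnion (Set.to_countable _) fun n _ =>
      measurableSet_le measurable_const
        (Finset.measurable_fun_sum _ fun y _ => hf.comp (measurable_shift y))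
  have hpt : ∀ ω, c * ∑ x ∈ cube (0 : Fin d → ℤ) N, E.indicator 1 (shift x ω) ≤
      4 ^ d * ∑ y ∈ cube (0 : Fin d → ℤ) (2 * N), f (shift y ω) := by
    intro ω
    set T := (cube (0 : Fin d → ℤ) N).filter fun x => shift x ω ∈ E with hT
    have h1 : ∑ x ∈ cube (0 : Fin d → ℤ) N, E.indicator (1 : Env d → ℝ≥0∞) (shift x ω) =
        T.card := by
      simp only [Set.indicator_apply, Pi.one_apply]
      rw [← Finset.sum_filter, Finset.sum_const, nsmul_eq_mul, mul_one]
    rw [h1]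
    have h2 : ∀ x, ∃ n : ℕ, x ∈ T → n ≤ N ∧
        c * (2 * (n : ℝ≥0∞) + 1) ^ d ≤ ∑ y ∈ cube x n, f (shift y ω) := by
      intro x
      by_cases hx : x ∈ T
      · obtain ⟨n, hn, h⟩ := (Finset.mem_filter.1 hx).2
        refine ⟨n, fun _ => ⟨hn, ?_⟩⟩
        rw [sum_cube_eq_sum_cube_zero]
        simpa only [shift_shift] using h
      · exact ⟨0, fun h => absurd h hx⟩
    choose n hn using h2
    refine mul_card_le_of_cube _ c T _ n (fun x hx => (hn x hx).2) fun x hx y hy => ?_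
    have hx' := mem_cube.1 (Finset.mem_filter.1 hx).1
    rw [mem_cube] at hy ⊢
    intro i
    have := (hn x hx).1
    have h3 := hx' i
    have h4 := hy i
    simp only [Pi.zero_apply, sub_zero, abs_le] at *
    push_cast
    constructor <;> omega
  have hint : c * ((2 * N + 1) ^ d * P E) ≤
      4 ^ d * ((2 * (2 * N) + 1) ^ d * ∫⁻ ω, f ω ∂P) := by
    have h := lintegral_mono (μ := P) hpt
    have hm : ∀ x : Fin d → ℤ, Measurable fun ω => E.indicator (1 : Env d → ℝ≥0∞) (shift x ω) :=
      fun x => (measurable_one.indicator hEm).comp (measurable_shift x)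
    have hfm : ∀ x : Fin d → ℤ, Measurable fun ω => f (shift x ω) :=
      fun x => hf.comp (measurable_shift x)
    rw [lintegral_const_mul _ (Finset.measurable_fun_sum _ fun x _ => hm x),
      lintegral_const_mul _ (Finset.measurable_fun_sum _ fun x _ => hfm x),
      lintegral_finsetSum _ (fun x _ => hm x), lintegral_finsetSum _ (fun x _ => hfm x)] at h
    simp only [lintegral_comp_shift hP hf,
      lintegral_comp_shift hP (measurable_one.indicator hEm), lintegral_indicator_one hEm,
      Finset.sum_const, card_cube, nsmul_eq_mul] at h
    exact_mod_cast h
  have hpos : ((2 * N + 1 : ℝ≥0∞)) ^ d ≠ 0 := by positivity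
  have htop : ((2 * N + 1 : ℝ≥0∞)) ^ d ≠ ∞ :=
    ENNReal.pow_ne_top (by exact_mod_cast ENNReal.natCast_ne_top (2 * N + 1))
  refine (ENNReal.mul_le_mul_iff_right hpos htop).1 ?_
  calc (2 * N + 1 : ℝ≥0∞) ^ d * (c * P E) = c * ((2 * N + 1) ^ d * P E) := by ring
    _ ≤ 4 ^ d * ((2 * (2 * N) + 1) ^ d * ∫⁻ ω, f ω ∂P) := hint
    _ ≤ 4 ^ d * ((2 * (2 * N + 1)) ^ d * ∫⁻ ω, f ω ∂P) := by
      gcongr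
      have : 2 * (2 * N) + 1 ≤ 2 * (2 * N + 1) := by omega
      exact_mod_cast this
    _ = (2 * N + 1) ^ d * (8 ^ d * ∫⁻ ω, f ω ∂P) := by
      rw [mul_pow, show (8 : ℝ≥0∞) = 4 * 2 by norm_num, mul_pow]; ring

/-- Wiener's maximal inequality for averages over cubes. -/
theorem IsAdmissibleLaw.maximal_ineq {P : Measure (Env d)} (hP : IsAdmissibleLaw P)
    {f : Env d → ℝ≥0∞} (hf : Measurable f) (c : ℝ≥0∞) :
    c * P {ω | ∃ n : ℕ, c * (2 * (n : ℝ≥0∞) + 1) ^ d ≤ ∑ y ∈ cube 0 n, f (shift y ω)} ≤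
      8 ^ d * ∫⁻ ω, f ω ∂P := by
  set E : ℕ → Set (Env d) := fun N =>
    {ω | ∃ n ≤ N, c * (2 * (n : ℝ≥0∞) + 1) ^ d ≤ ∑ y ∈ cube 0 n, f (shift y ω)} with hE
  have hmono : Monotone E := fun N M h ω ⟨n, hn, h'⟩ => ⟨n, hn.trans h, h'⟩
  have hU : {ω | ∃ n : ℕ, c * (2 * (n : ℝ≥0∞) + 1) ^ d ≤ ∑ y ∈ cube 0 n, f (shift y ω)} =
      ⋃ N, E N := by
    ext ω
    simp only [hE, Set.mem_iUnion, Set.mem_ofPred_eq]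
    exact ⟨fun ⟨n, h⟩ => ⟨n, n, le_rfl, h⟩, fun ⟨_, n, _, h⟩ => ⟨n, h⟩⟩
  rw [hU, hmono.measure_iUnion, ENNReal.mul_iSup]
  exact iSup_le fun N => hP.maximal_ineq_aux hf c N

/-- Functions with rapidly decreasing means have, eventually, small averages over all cubes. -/
theorem IsAdmissibleLaw.ae_eventually_sum_cube_le {P : Measure (Env d)} (hP : IsAdmissibleLaw P)
    {f : ℕ → Env d → ℝ≥0∞} (hf : ∀ k, Measurable (f k))
    (hfk : ∀ k, ∫⁻ ω, f k ω ∂P ≤ (4⁻¹ : ℝ≥0∞) ^ k) :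
    ∀ᵐ ω ∂P, ∀ᶠ k in atTop, ∀ n : ℕ,
      ∑ y ∈ cube 0 n, f k (shift y ω) ≤ (2⁻¹ : ℝ≥0∞) ^ k * (2 * (n : ℝ≥0∞) + 1) ^ d := by
  set E : ℕ → Set (Env d) := fun k => {ω | ∃ n : ℕ,
    (2⁻¹ : ℝ≥0∞) ^ k * (2 * (n : ℝ≥0∞) + 1) ^ d ≤ ∑ y ∈ cube 0 n, f k (shift y ω)} with hE
  -- The level $2^{-k}$ against a mean of at most $4^{-k}$ leaves a summable $2^{-k}$ for
  -- Borel–Cantelli.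
  have hPE : ∀ k, P (E k) ≤ 8 ^ d * (2⁻¹ : ℝ≥0∞) ^ k := by
    intro k
    have h := (hP.maximal_ineq (hf k) ((2⁻¹ : ℝ≥0∞) ^ k)).trans
      (mul_le_mul_right (hfk k) (8 ^ d))
    refine (ENNReal.mul_le_mul_iff_right (a := (2⁻¹ : ℝ≥0∞) ^ k) ?_ ?_).1 (h.trans_eq ?_)
    · simp
    · exact ENNReal.pow_ne_top (by simp)
    · rw [show (4⁻¹ : ℝ≥0∞) = 2⁻¹ * 2⁻¹ by
        rw [← ENNReal.mul_inv (by simp) (by simp)]; norm_num, mul_pow]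
      ring
  have hsum : ∑' k, P (E k) ≠ ∞ := by
    refine ne_top_of_le_ne_top ?_ (ENNReal.tsum_le_tsum hPE)
    rw [ENNReal.tsum_mul_left, ENNReal.tsum_geometric]
    refine ENNReal.mul_ne_top (by simp) ?_
    simp
  filter_upwards [ae_eventually_notMem hsum] with ω hω
  filter_upwards [hω] with k hk n
  by_contra! h
  exact hk ⟨n, h.le⟩

/-! ### A weak Poincaré inequality -/

/-- The median is the least value of `u` strictly above which at most half of the points lie. -/
theorem exists_median {α : Type*} (S : Finset α) (u : α → ℝ) :
    ∃ m : ℝ, 2 * (S.filter fun x => m < u x).card ≤ S.card ∧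
      2 * (S.filter fun x => u x < m).card ≤ S.card := by
  classical
  rcases S.eq_empty_or_nonempty with rfl | hS
  · exact ⟨0, by simp⟩
  set V := (S.image u).filter fun v => 2 * (S.filter fun x => v < u x).card ≤ S.card with hV
  have hVne : V.Nonempty := by
    refine ⟨(S.image u).max' (hS.image u), Finset.mem_filter.2 ⟨Finset.max'_mem _ _, ?_⟩⟩
    rw [Finset.filter_false_of_mem]
    · simp
    · exact fun x hx => not_lt.2 (Finset.le_max' _ _ (Finset.mem_image_of_mem u hx))
  refine ⟨V.min' hVne, (Finset.mem_filter.1 (V.min'_mem hVne)).2, ?_⟩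
  set m := V.min' hVne with hm
  rcases (S.filter fun x => u x < m).eq_empty_or_nonempty with h0 | hne
  · rw [h0]; simp
  -- Let `u x₀` be the largest value below `m`. By minimality of `m`, more than half of the points
  -- exceed it, and no point below `m` is among them.
  obtain ⟨x₀, hx₀, hmax⟩ := Finset.exists_max_image _ u hne
  obtain ⟨hx₀S, hx₀m⟩ := Finset.mem_filter.1 hx₀
  have hnot : u x₀ ∉ V := fun h => absurd (V.min'_le _ h) (not_le.2 hx₀m)
  have h1 : S.card < 2 * (S.filter fun x => u x₀ < u x).card := by
    by_contra! h
    exact hnot (Finset.mem_filter.2 ⟨Finset.mem_image_of_mem u hx₀S, h⟩)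
  have h2 : (S.filter fun x => u x < m) ⊆ S.filter fun x => ¬ u x₀ < u x := fun x hx =>
    Finset.mem_filter.2 ⟨(Finset.mem_filter.1 hx).1, not_lt.2 (hmax x hx)⟩
  have h3 := Finset.card_le_card h2
  have h4 := Finset.card_filter_add_card_filter_not (s := S) fun x => u x₀ < u x
  omega

open Classical in
/-- A discrete co-area estimate: an isoperimetric inequality for the superlevel sets of `v ≥ 0`
bounds the sum of `v` by the sum of its increments. -/
theorem mul_sum_le_sum_sub {α : Type*} (S : Finset α) (a : α → α → Prop) (v : α → ℝ) (c : ℝ)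
    (hc : 0 ≤ c) (hv : ∀ x, 0 ≤ v x)
    (h : ∀ t : ℝ, 0 ≤ t → c * (S.filter fun x => t < v x).card ≤
      ((S ×ˢ S).filter fun p => a p.1 p.2 ∧ v p.2 ≤ t ∧ t < v p.1).card) :
    c * ∑ x ∈ S, v x ≤ ∑ p ∈ (S ×ˢ S).filter fun p => a p.1 p.2, max (v p.1 - v p.2) 0 := by
  have key : ENNReal.ofReal c * ∑ x ∈ S, ENNReal.ofReal (v x) ≤
      ∑ p ∈ (S ×ˢ S).filter fun p => a p.1 p.2, ENNReal.ofReal (v p.1 - v p.2) := by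
    -- Layer cake: $(y-x)^+$ is the length of $[x,y)$. In `ℝ≥0∞` the truncation is automatic and no
    -- integrability has to be checked.
    have h1 : ∀ x y : ℝ, ENNReal.ofReal (y - x) =
        ∫⁻ t : ℝ, (Set.Ico x y).indicator (fun _ => (1 : ℝ≥0∞)) t := by
      intro x y
      rw [lintegral_indicator_const measurableSet_Ico, Real.volume_Ico, one_mul]
    have hm : ∀ x y : ℝ, Measurable fun t => (Set.Ico x y).indicator (fun _ => (1 : ℝ≥0∞)) t :=
      fun x y => measurable_const.indicator measurableSet_Ico
    have h2 : ∀ x, ENNReal.ofReal (v x) =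
        ∫⁻ t : ℝ, (Set.Ico 0 (v x)).indicator (fun _ => (1 : ℝ≥0∞)) t := by
      intro x; rw [← h1, sub_zero]
    simp only [h1, h2]
    rw [← lintegral_finsetSum _ fun x _ => hm _ _, ← lintegral_finsetSum _ fun x _ => hm _ _,
      ← lintegral_const_mul _ (Finset.measurable_fun_sum _ fun x _ => hm _ _)]
    refine lintegral_mono fun t => ?_
    simp only [Set.indicator_apply, Set.mem_Ico]
    rw [← Finset.sum_filter, ← Finset.sum_filter, Finset.sum_const, Finset.sum_const,
      nsmul_eq_mul, nsmul_eq_mul, mul_one, mul_one]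
    rcases lt_or_ge t 0 with ht | ht
    · rw [Finset.filter_false_of_mem (fun x _ hx => absurd hx.1 (not_le.2 ht))]
      simp
    · have h3 := h t ht
      rw [Finset.filter_filter]
      simp only [ht, true_and]
      have h4 := ENNReal.ofReal_le_ofReal h3
      rwa [ENNReal.ofReal_mul hc, ENNReal.ofReal_natCast, ENNReal.ofReal_natCast] at h4
  have hL : ENNReal.ofReal c * ∑ x ∈ S, ENNReal.ofReal (v x) =
      ENNReal.ofReal (c * ∑ x ∈ S, v x) := by
    rw [ENNReal.ofReal_mul hc, ENNReal.ofReal_sum_of_nonneg fun x _ => hv x]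
  have hR : ∑ p ∈ (S ×ˢ S).filter fun p => a p.1 p.2, ENNReal.ofReal (v p.1 - v p.2) =
      ENNReal.ofReal (∑ p ∈ (S ×ˢ S).filter fun p => a p.1 p.2, max (v p.1 - v p.2) 0) := by
    rw [ENNReal.ofReal_sum_of_nonneg fun x _ => le_max_right _ _]
    refine Finset.sum_congr rfl fun p _ => ?_
    rcases le_total 0 (v p.1 - v p.2) with h | h
    · rw [max_eq_left h]
    · rw [max_eq_right h, ENNReal.ofReal_of_nonpos h, ENNReal.ofReal_zero]
  rw [hL, hR] at key
  exact (ENNReal.ofReal_le_ofReal_iff (Finset.sum_nonneg fun x _ => le_max_right _ _)).1 key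

open Classical in
/-- The weak relative isoperimetric inequality implies an `ℓ¹`-Poincaré inequality. -/
theorem exists_sum_abs_sub_le_of_isoperimetric {ω : Env d} (S : Finset (Fin d → ℤ)) {c : ℝ}
    (hc : 0 ≤ c) (hS : ∀ A : Set (Fin d → ℤ), A ⊆ S →
      (A.ncard : ℝ) ≤ 1 / 2 * ((S : Set (Fin d → ℤ)).ncard : ℝ) →
      c * (A.ncard : ℝ) ≤ ((relBoundary ω S A).ncard : ℝ)) (u : (Fin d → ℤ) → ℝ) :
    ∃ m : ℝ, c * ∑ x ∈ S, |u x - m| ≤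
      ∑ p ∈ (S ×ˢ S).filter fun p => (openGraph ω).Adj p.1 p.2, |u p.1 - u p.2| := by
  obtain ⟨m, hm1, hm2⟩ := exists_median S u
  refine ⟨m, ?_⟩
  -- Superlevel sets at nonnegative heights of $(u-m)^+$ and of $(m-u)^+$ contain at most half of
  -- `S`, so the isoperimetric inequality applies to them.
  have key : ∀ w : (Fin d → ℤ) → ℝ, 2 * (S.filter fun x => 0 < w x).card ≤ S.card →
      c * ∑ x ∈ S, max (w x) 0 ≤ ∑ p ∈ (S ×ˢ S).filter fun p => (openGraph ω).Adj p.1 p.2,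
        max (max (w p.1) 0 - max (w p.2) 0) 0 := by
    intro w hw
    refine mul_sum_le_sum_sub S (openGraph ω).Adj (fun x => max (w x) 0) c hc
      (fun x => le_max_right _ _) fun t ht => ?_
    have hlt : ∀ x, t < max (w x) 0 ↔ t < w x := fun x => by
      rw [lt_max_iff]; exact or_iff_left (not_lt.2 ht)
    have hle : ∀ x, max (w x) 0 ≤ t ↔ ¬ t < w x := fun x => by rw [← hlt, not_lt]
    simp only [hlt, hle]
    set A := S.filter fun x => t < w x with hA
    have hAS : (A : Set (Fin d → ℤ)) ⊆ S := by exact_mod_cast Finset.filter_subset _ _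
    have hAc : A.card ≤ (S.filter fun x => 0 < w x).card :=
      Finset.card_le_card fun x hx => by
        simp only [hA, Finset.mem_filter] at hx ⊢
        exact ⟨hx.1, ht.trans_lt hx.2⟩
    have h1 := hS A hAS (by
      rw [Set.ncard_coe_finset, Set.ncard_coe_finset]
      have : 2 * A.card ≤ S.card := by omega
      have : (2 : ℝ) * A.card ≤ S.card := by exact_mod_cast this
      linarith)
    rw [Set.ncard_coe_finset] at h1
    refine h1.trans ?_
    -- Every boundary edge comes from a pair oriented from `A` to its complement, and passing to
    -- unoriented edges can only lower the count.
    have hsub : relBoundary ω S A ⊆ ((((S ×ˢ S).filter fun p =>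
        (openGraph ω).Adj p.1 p.2 ∧ ¬ t < w p.2 ∧ t < w p.1).image
          fun p => s(p.1, p.2) : Finset (Sym2 (Fin d → ℤ))) : Set (Sym2 (Fin d → ℤ))) := by
      rintro e ⟨x, hx, y, ⟨hyS, hyA⟩, hadj, rfl⟩
      rw [Finset.mem_coe] at hx hyS hyA
      have hx' := Finset.mem_filter.1 hx
      refine Finset.mem_coe.2 (Finset.mem_image.2 ⟨(x, y), Finset.mem_filter.2 ⟨?_, hadj, ?_, ?_⟩,
        rfl⟩)
      · exact Finset.mem_product.2 ⟨hx'.1, hyS⟩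
      · exact fun h => hyA (Finset.mem_filter.2 ⟨hyS, h⟩)
      · exact hx'.2
    have h2 := Set.ncard_le_ncard hsub (Finset.finite_toSet _)
    rw [Set.ncard_coe_finset] at h2
    exact_mod_cast h2.trans Finset.card_image_le
  have hp := key (fun x => u x - m) (by simpa only [sub_pos] using hm1)
  have hn := key (fun x => m - u x) (by simpa only [sub_pos] using hm2)
  calc c * ∑ x ∈ S, |u x - m|
      = c * ∑ x ∈ S, max (u x - m) 0 + c * ∑ x ∈ S, max (m - u x) 0 := by
        rw [← mul_add, ← Finset.sum_add_distrib]
        congr 1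
        refine Finset.sum_congr rfl fun x _ => ?_
        rcases le_total (u x) m with h | h
        · rw [abs_of_nonpos (by linarith), max_eq_right (by linarith), max_eq_left (by linarith)]
          ring
        · rw [abs_of_nonneg (by linarith), max_eq_left (by linarith), max_eq_right (by linarith)]
          ring
    _ ≤ _ := add_le_add hp hn
    -- For each ordered pair at most one of the two positive parts is nonzero, according to the sign
    -- of `u p.1 - u p.2`.
    _ ≤ _ := by
        rw [← Finset.sum_add_distrib]
        refine Finset.sum_le_sum fun p _ => ?_
        rcases le_total (u p.1) m with h1 | h1 <;> rcases le_total (u p.2) m with h2 | h2 <;>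
          rcases le_total (u p.1) (u p.2) with h3 | h3 <;>
          simp only [max_def, abs_of_nonneg, abs_of_nonpos, sub_nonneg, sub_nonpos, h3] <;>
          split_ifs <;> linarith

/-! ### From oscillations to averages -/

/-- If the oscillation of `f` over a doubling sequence of sets is sublinear, then so is the average
of `|f|`. -/
theorem tendsto_average_of_oscillation {α : Type*} (b : ℕ → Finset α) (hb : Monotone b)
    (f : α → ℝ) (K : ℝ) (hne : ∀ᶠ n in atTop, (b n).Nonempty)
    (hK : ∀ᶠ n in atTop, ((b n).card : ℝ) ≤ K * (b (n / 2)).card)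
    (hosc : ∀ ε : ℝ, 0 < ε → ∀ᶠ n : ℕ in atTop, ∃ m : ℝ,
      ∑ x ∈ b n, |f x - m| ≤ ε * n * (b n).card) :
    Tendsto (fun n : ℕ => 1 / ((b n).card : ℝ) * ∑ x ∈ b n, |1 / (n : ℝ) * f x|)
      atTop (𝓝 0) := by
  have hK0 : 0 ≤ K := by
    obtain ⟨n, h1, h2⟩ := (hK.and hne).exists
    by_contra! hneg
    have : (0 : ℝ) < (b n).card := by exact_mod_cast h2.card_pos
    have : K * ((b (n / 2)).card : ℝ) ≤ 0 := mul_nonpos_of_nonpos_of_nonneg hneg.le (by positivity)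
    linarith
  rw [Metric.tendsto_atTop]
  intro η hη
  -- The final bound is `(2 * K + 4) * ε`: one `ε` from the oscillation, one from `M₀`, and `2 * (K
  -- + 1) * ε` from the dyadic sum.
  set ε := η / (2 * K + 5) with hε
  have hε0 : 0 < ε := by positivity
  obtain ⟨N, hN⟩ := eventually_atTop.1
    (((hne.and hK).and (hosc ε hε0)).and (eventually_gt_atTop 0))
  have hN0 : 0 < N := (hN N le_rfl).2
  replace hN := fun n hn => (hN n hn).1
  have hm : ∀ n, ∃ m : ℝ, N ≤ n → ∑ x ∈ b n, |f x - m| ≤ ε * n * (b n).card := by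
    intro n
    by_cases h : N ≤ n
    · exact (hN n h).2.imp fun m hm _ => hm
    · exact ⟨0, fun h' => absurd h' h⟩
  choose m hm using hm
  -- Covers the base scales $N\le n<2N$, where halving would leave the range of validity.
  set M₀ := ∑ i ∈ Finset.range (2 * N), |m i| with hM₀
  have hM₀0 : 0 ≤ M₀ := Finset.sum_nonneg fun _ _ => abs_nonneg _
  -- Iterates $|m_n|\le|m_{n/2}|+(K+1)\varepsilon n$; the factor 2 is the geometric series. The
  -- increment is estimated by averaging $|f-m_n|+|f-m_{n/2}|$ over the smaller set, with doubling
  -- paying for the larger one.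
  have hbound : ∀ n, N ≤ n → |m n| ≤ M₀ + 2 * (K + 1) * ε * n := by
    intro n
    induction n using Nat.strong_induction_on with
    | _ n ih =>
      intro hn
      rcases lt_or_ge n (2 * N) with h2 | h2
      · have : |m n| ≤ M₀ := Finset.single_le_sum (f := fun i => |m i|)
          (fun _ _ => abs_nonneg _) (Finset.mem_range.2 h2)
        have : 0 ≤ 2 * (K + 1) * ε * n := by positivity
        linarith
      have hn' : N ≤ n / 2 := by omega
      have ih' := ih (n / 2) (by omega) hn'
      have hcast : ((n / 2 : ℕ) : ℝ) ≤ n / 2 := Nat.cast_div_le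
      have hcard : (0 : ℝ) < (b (n / 2)).card := by exact_mod_cast (hN _ hn').1.1.card_pos
      have h1 : ((b (n / 2)).card : ℝ) * |m n - m (n / 2)| ≤
          ε * n * (b n).card + ε * (n / 2 : ℕ) * (b (n / 2)).card := by
        calc ((b (n / 2)).card : ℝ) * |m n - m (n / 2)|
            = ∑ x ∈ b (n / 2), |m n - m (n / 2)| := by rw [Finset.sum_const, nsmul_eq_mul]
          _ ≤ ∑ x ∈ b (n / 2), (|f x - m n| + |f x - m (n / 2)|) := by
              refine Finset.sum_le_sum fun x _ => ?_
              rw [abs_sub_comm (f x) (m n)]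
              exact (by ring : m n - m (n / 2) = (m n - f x) + (f x - m (n / 2))) ▸ abs_add_le _ _
          _ = ∑ x ∈ b (n / 2), |f x - m n| + ∑ x ∈ b (n / 2), |f x - m (n / 2)| :=
              Finset.sum_add_distrib
          _ ≤ _ := by
              refine add_le_add (le_trans ?_ (hm n hn)) (hm _ hn')
              exact Finset.sum_le_sum_of_subset_of_nonneg (hb (Nat.div_le_self _ _))
                fun _ _ _ => abs_nonneg _
      have h2 : ((b (n / 2)).card : ℝ) * |m n - m (n / 2)| ≤
          (b (n / 2)).card * ((K + 1) * ε * n) := by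
        have hKn := (hN n hn).1.2
        have e1 : ε * n * (b n).card ≤ ε * n * (K * (b (n / 2)).card) := by gcongr
        have e2 : ε * (n / 2 : ℕ) * (b (n / 2)).card ≤ ε * n * (b (n / 2)).card := by
          gcongr
          exact Nat.div_le_self _ _
        calc _ ≤ ε * n * (K * (b (n / 2)).card) + ε * n * (b (n / 2)).card :=
              h1.trans (add_le_add e1 e2)
          _ = _ := by ring
      have h3 := le_of_mul_le_mul_left h2 hcard
      have h4 : |m n| ≤ |m (n / 2)| + |m n - m (n / 2)| := by
        have := abs_add_le (m (n / 2)) (m n - m (n / 2))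
        rwa [add_sub_cancel] at this
      have h5 : 2 * (K + 1) * ε * (n / 2 : ℕ) ≤ 2 * (K + 1) * ε * (n / 2) := by gcongr
      linarith
  obtain ⟨N₁, hN₁⟩ := exists_nat_ge (M₀ / ε)
  refine ⟨max N (max N₁ 1), fun n hn => ?_⟩
  have hnN : N ≤ n := le_of_max_le_left hn
  have hnN₁ : N₁ ≤ n := le_of_max_le_left (le_of_max_le_right hn)
  have hn1 : 1 ≤ n := le_of_max_le_right (le_of_max_le_right hn)
  have hn0 : (0 : ℝ) < n := by exact_mod_cast hn1
  have hcard : (0 : ℝ) < (b n).card := by exact_mod_cast (hN _ hnN).1.1.card_pos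
  have hM₀n : M₀ ≤ ε * n := by
    have : M₀ / ε ≤ n := hN₁.trans (by exact_mod_cast hnN₁)
    rw [div_le_iff₀ hε0] at this
    linarith
  have hsum : ∑ x ∈ b n, |f x| ≤ (b n).card * n * ((2 * K + 4) * ε) := by
    calc ∑ x ∈ b n, |f x| ≤ ∑ x ∈ b n, (|f x - m n| + |m n|) := by
          refine Finset.sum_le_sum fun x _ => ?_
          have := abs_add_le (f x - m n) (m n)
          rwa [sub_add_cancel] at this
      _ = ∑ x ∈ b n, |f x - m n| + (b n).card * |m n| := by
          rw [Finset.sum_add_distrib, Finset.sum_const, nsmul_eq_mul]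
      _ ≤ ε * n * (b n).card + (b n).card * (ε * n + 2 * (K + 1) * ε * n) := by
          gcongr
          · exact hm n hnN
          · linarith [hbound n hnN]
      _ = (b n).card * n * ((2 * K + 4) * ε) := by ring
  have heq : 1 / ((b n).card : ℝ) * ∑ x ∈ b n, |1 / (n : ℝ) * f x| =
      (∑ x ∈ b n, |f x|) / ((b n).card * n) := by
    simp only [abs_mul, ← Finset.mul_sum]
    rw [abs_of_nonneg (by positivity)]
    field_simp
  rw [Real.dist_eq, sub_zero, heq, abs_of_nonneg
    (div_nonneg (Finset.sum_nonneg fun _ _ => abs_nonneg _) (by positivity)),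
    div_lt_iff₀ (by positivity)]
  refine hsum.trans_lt ?_
  have : (2 * K + 4) * ε < η := by
    rw [hε, mul_div_assoc', div_lt_iff₀ (by positivity)]
    nlinarith
  rw [mul_comm η]
  gcongr

/-! ### Approximation of potential fields in `L¹` along open edges -/

/-- The sum of `|Ψ|` over the open edges at the origin, when the latter is in the infinite
cluster. -/
noncomputable def localSum (Ψ : Env d → (Fin d → ℤ) → ℝ) : Env d → ℝ≥0∞ :=
  {ω | 0 ∈ cluster ω}.indicator fun ω =>
    ∑ e ∈ unitSteps d, {ω | (openGraph ω).Adj 0 e}.indicator (fun ω => ‖Ψ ω e‖ₑ) ω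

theorem measurable_localSum {Ψ : Env d → (Fin d → ℤ) → ℝ} (hΨ : ∀ x, Measurable fun ω => Ψ ω x) :
    Measurable (localSum Ψ) :=
  (Finset.measurable_fun_sum _ fun e _ =>
    ((hΨ e).enorm.indicator (measurableSet_adj 0 e))).indicator (measurableSet_mem_cluster 0)

theorem measurable_grad {φ : Env d → ℝ} (hφ : Measurable φ) (x : Fin d → ℤ) :
    Measurable fun ω => grad φ ω x :=
  (hφ.comp (measurable_shift x)).sub hφ

/-- Split according to whether $sa\ge1$. This form of Young's inequality, with a free parameter,
stands in for Cauchy–Schwarz. -/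
theorem le_mul_sq_add_inv (a : ℝ≥0∞) {s : ℝ≥0∞} (hs : s ≠ 0) (hs' : s ≠ ∞) :
    a ≤ s * a ^ 2 + s⁻¹ := by
  rcases le_total 1 (s * a) with h | h
  · calc a = 1 * a := (one_mul a).symm
      _ ≤ s * a * a := by gcongr
      _ = s * a ^ 2 := by ring
      _ ≤ _ := le_self_add
  · refine le_add_left ?_
    rw [← one_mul s⁻¹, ← div_eq_mul_inv, ENNReal.le_div_iff_mul_le (Or.inl hs) (Or.inl hs'),
      mul_comm]
    exact h

/-- On an open edge of conductance $w$, Young's inequality with parameter $sw$ gives $|\Psi|\le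
s\,w|\Psi|^2+s^{-1}w^{-1}$. Replacing $\mathbb P$ restricted to $\{0\in\mathcal C_\infty\}$ by
$\mathbb P_0$ only increases the first term. -/
theorem lintegral_localSum_le {P : Measure (Env d)} [IsProbabilityMeasure P]
    {Ψ : Env d → (Fin d → ℤ) → ℝ} (hΨ : ∀ x, Measurable fun ω => Ψ ω x)
    {s : ℝ≥0∞} (hs : s ≠ 0) (hs' : s ≠ ∞) :
    ∫⁻ ω, localSum Ψ ω ∂P ≤ s * covNormSq P Ψ + s⁻¹ * ∑ e ∈ unitSteps d, ∫⁻ ω,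
      (if 0 < conductance ω 0 e then (((conductance ω 0 e)⁻¹ : ℝ≥0) : ℝ≥0∞) else 0) ∂P := by
  have hg : ∀ e : Fin d → ℤ, Measurable fun ω : Env d =>
      (if 0 < conductance ω 0 e then (((conductance ω 0 e)⁻¹ : ℝ≥0) : ℝ≥0∞) else 0) := fun e =>
    Measurable.ite (measurableSet_adj 0 e)
      (measurable_conductance 0 e).inv.coe_nnreal_ennreal measurable_const
  have hf : Measurable fun ω : Env d =>
      ∑ x ∈ unitSteps d, (conductance ω 0 x : ℝ≥0∞) * ‖Ψ ω x‖ₑ ^ 2 :=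
    Finset.measurable_fun_sum _ fun x _ =>
      (measurable_conductance 0 x).coe_nnreal_ennreal.mul ((hΨ x).enorm.pow_const 2)
  have hpt : ∀ ω, localSum Ψ ω ≤ s * {ω | 0 ∈ cluster ω}.indicator (fun ω =>
        ∑ x ∈ unitSteps d, (conductance ω 0 x : ℝ≥0∞) * ‖Ψ ω x‖ₑ ^ 2) ω +
      s⁻¹ * ∑ e ∈ unitSteps d,
        (if 0 < conductance ω 0 e then (((conductance ω 0 e)⁻¹ : ℝ≥0) : ℝ≥0∞) else 0) := by
    intro ω
    by_cases h0 : ω ∈ {ω : Env d | 0 ∈ cluster ω}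
    · rw [localSum, Set.indicator_of_mem h0, Set.indicator_of_mem h0, Finset.mul_sum,
        Finset.mul_sum, ← Finset.sum_add_distrib]
      refine Finset.sum_le_sum fun e _ => ?_
      by_cases he : 0 < conductance ω 0 e
      · rw [Set.indicator_of_mem (show ω ∈ {ω : Env d | (openGraph ω).Adj 0 e} from he), if_pos he,
          ENNReal.coe_inv he.ne', ← mul_assoc,
          ← ENNReal.mul_inv (Or.inl hs) (Or.inl hs')]
        exact le_mul_sq_add_inv _ (mul_ne_zero hs (by exact_mod_cast he.ne'))
          (ENNReal.mul_ne_top hs' ENNReal.coe_ne_top)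
      · rw [Set.indicator_of_notMem (show ω ∉ {ω : Env d | (openGraph ω).Adj 0 e} from he)]
        exact zero_le
    · rw [localSum, Set.indicator_of_notMem h0]
      exact zero_le
  refine (lintegral_mono hpt).trans ?_
  rw [lintegral_add_left ((hf.indicator (measurableSet_mem_cluster 0)).const_mul s),
    lintegral_const_mul _ (hf.indicator (measurableSet_mem_cluster 0)),
    lintegral_const_mul _ (Finset.measurable_fun_sum _ fun e _ => hg e),
    lintegral_finsetSum _ fun e _ => hg e, lintegral_indicator (measurableSet_mem_cluster 0)]
  gcongr
  rw [covNormSq, lintegral_condLaw]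
  refine (one_mul _).symm.trans_le (mul_le_mul_left ?_ _)
  exact ENNReal.one_le_inv.2 prob_le_one

theorem exists_isLocal_lintegral_localSum_le {P : Measure (Env d)} [IsProbabilityMeasure P]
    (hinv : ∀ e : Edge d,
      ∫⁻ ω, (if 0 < ω e then (((ω e)⁻¹ : ℝ≥0) : ℝ≥0∞) else 0) ∂P < ∞)
    {χ : Env d → (Fin d → ℤ) → ℝ} (hχ : MemLpot P χ) {δ : ℝ≥0∞} (hδ : δ ≠ 0) (hδ' : δ ≠ ∞) :
    ∃ φ : Env d → ℝ, IsLocal φ ∧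
      ∫⁻ ω, localSum (fun ω x => χ ω x - grad φ ω x) ω ∂P ≤ δ := by
  set G := ∑ e ∈ unitSteps d, ∫⁻ ω,
      (if 0 < conductance ω 0 e then (((conductance ω 0 e)⁻¹ : ℝ≥0) : ℝ≥0∞) else 0) ∂P with hG
  have hGtop : G ≠ ∞ := by
    refine ENNReal.sum_ne_top.2 fun e he => ?_
    have hadj := mem_unitSteps.1 he
    simp only [conductance, dif_pos hadj]
    exact (hinv _).ne
  have hδ2 : δ / 2 ≠ 0 := by simp [hδ]
  have hδ2' : δ / 2 ≠ ∞ := ENNReal.div_ne_top hδ' (by simp)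
  -- Large enough for the inverse-conductance term to be at most `δ / 2`; the `+ 1` keeps `s`
  -- nonzero when `G = 0`.
  set s := (G + 1) / (δ / 2) with hs
  have hs0 : s ≠ 0 := by simp [hs, hδ2']
  have hs1 : s ≠ ∞ := ENNReal.div_ne_top (by simp [hGtop]) hδ2
  have hsG : s⁻¹ * G ≤ δ / 2 := by
    rw [hs, ENNReal.inv_div (Or.inl hδ2') (Or.inl hδ2), mul_comm, ← mul_div_assoc]
    refine ENNReal.div_le_of_le_mul' ?_
    gcongr
    exact le_self_add
  obtain ⟨φ, hφ, hlt⟩ := hχ.2 (δ / 2 / s) (ENNReal.div_pos hδ2 hs1)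
  refine ⟨φ, hφ, ?_⟩
  refine (lintegral_localSum_le
    (fun x => (hχ.1.measurable x).sub (measurable_grad hφ.measurable x)) hs0 hs1).trans ?_
  calc _ ≤ s * (δ / 2 / s) + δ / 2 := add_le_add (mul_le_mul_right hlt.le s) hsG
    _ = δ := by rw [ENNReal.mul_div_cancel hs0 hs1, ENNReal.add_halves]

/-! ### Sublinearity -/

open Classical in
-- By the cocycle property, the increment across an open edge from `x` to `y` is, up to sign, the
-- field `χ - grad φ` in the environment seen from `x`, at the unit step `y - x`.
theorem sum_enorm_sub_le_sum_localSum {ω : Env d} {χ : Env d → (Fin d → ℤ) → ℝ}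
    (hco : ∀ x ∈ cluster ω, ∀ y ∈ cluster ω, χ (shift x ω) (y - x) = χ ω y - χ ω x)
    (φ : Env d → ℝ) (S : Finset (Fin d → ℤ)) (hS : ∀ x ∈ S, x ∈ cluster ω) :
    ∑ p ∈ (S ×ˢ S).filter fun p => (openGraph ω).Adj p.1 p.2,
        ‖(χ ω p.1 - φ (shift p.1 ω)) - (χ ω p.2 - φ (shift p.2 ω))‖ₑ ≤
      ∑ x ∈ S, localSum (fun ω x => χ ω x - grad φ ω x) (shift x ω) := by
  rw [Finset.sum_filter, Finset.sum_product]
  refine Finset.sum_le_sum fun x hx => ?_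
  have h0 : shift x ω ∈ {ω : Env d | 0 ∈ cluster ω} :=
    mem_cluster_shift.2 (by simpa using hS x hx)
  rw [localSum, Set.indicator_of_mem h0, ← Finset.sum_filter]
  have hinj : Set.InjOn (fun y => y - x) (S.filter fun y => (openGraph ω).Adj x y) :=
    fun a _ b _ h => by simpa using h
  refine le_trans (le_of_eq ?_) (Finset.sum_le_sum_of_subset
    (s := (S.filter fun y => (openGraph ω).Adj x y).image fun y => y - x) ?_)
  · rw [Finset.sum_image hinj]
    refine Finset.sum_congr rfl fun y hy => ?_
    obtain ⟨hyS, hadj⟩ := Finset.mem_filter.1 hy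
    rw [Set.indicator_of_mem]
    · simp only [grad, shift_shift, add_sub_cancel, hco x (hS x hx) y (hS y hyS)]
      rw [← enorm_neg]
      congr 1
      ring
    · show (openGraph (shift x ω)).Adj 0 (y - x)
      rw [openGraph_adj_shift]
      simpa using hadj
  · intro e he
    obtain ⟨y, hy, rfl⟩ := Finset.mem_image.1 he
    exact sub_mem_unitSteps (Finset.mem_filter.1 hy).2

theorem card_ball_eq_ncard (ω : Env d) (x : Fin d → ℤ) (r : ℝ) :
    ((finite_ball ω x r).toFinset.card : ℝ) = ((ball ω x r).ncard : ℝ) := by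
  rw [Set.ncard_eq_toFinset_card _ (finite_ball ω x r)]

theorem card_ball_le (ω : Env d) (n : ℕ) :
    (finite_ball ω 0 (n : ℝ)).toFinset.card ≤ (2 * n + 1) ^ d := by
  rw [← card_cube (0 : Fin d → ℤ)]
  refine Finset.card_le_card fun y hy => ?_
  have := mem_cube_of_mem_ball ((Set.Finite.mem_toFinset _).1 hy)
  rwa [Nat.floor_natCast] at this

/-- The Poincaré inequality is used on the set `S` between the ball and its enlargement; `S` lies in
a cube of radius $L=\lfloor C_{\mathrm W}n\rfloor$, where `hsum` bounds the gradient. Since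
$C_{\mathrm W}n\ge1$, $2L+1\le3C_{\mathrm W}n$. -/
theorem IsRegularBall.exists_sum_abs_sub_le {CV Criso CW : ℝ} (hCriso : 0 < Criso) (hCW : 1 ≤ CW)
    {ω : Env d} {n : ℕ} (hn : 1 ≤ n) (hreg : IsRegularBall CV Criso CW ω 0 n)
    {χ : Env d → (Fin d → ℤ) → ℝ}
    (hco : ∀ x ∈ cluster ω, ∀ y ∈ cluster ω, χ (shift x ω) (y - x) = χ ω y - χ ω x)
    (φ : Env d → ℝ) {q : ℝ} (hq : 0 ≤ q)
    (hsum : ∀ L : ℕ, ∑ y ∈ cube 0 L, localSum (fun ω x => χ ω x - grad φ ω x) (shift y ω) ≤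
      ENNReal.ofReal q * (2 * (L : ℝ≥0∞) + 1) ^ d) :
    ∃ m : ℝ, Criso * ∑ x ∈ (finite_ball ω 0 n).toFinset, |χ ω x - φ (shift x ω) - m| ≤
      n * (q * (3 * CW * n) ^ d) := by
  classical
  obtain ⟨-, S, hSC, -, hBS, hSB, hiso⟩ := hreg
  have hSfin : S.Finite := (finite_ball ω 0 (CW * n)).subset hSB
  lift S to Finset (Fin d → ℤ) using hSfin
  have hn0 : (0 : ℝ) < n := by exact_mod_cast hn
  have hn1 : (1 : ℝ) ≤ n := by exact_mod_cast hn
  obtain ⟨m, hm⟩ := exists_sum_abs_sub_le_of_isoperimetric S (c := Criso * (n : ℝ)⁻¹)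
    (by positivity) hiso fun x => χ ω x - φ (shift x ω)
  refine ⟨m, ?_⟩
  set L := ⌊CW * n⌋₊ with hL
  have hS : S ⊆ cube 0 L := fun x hx => mem_cube_of_mem_ball (hSB hx)
  have hgrad : ∑ p ∈ (S ×ˢ S).filter fun p => (openGraph ω).Adj p.1 p.2,
      |(χ ω p.1 - φ (shift p.1 ω)) - (χ ω p.2 - φ (shift p.2 ω))| ≤ q * (3 * CW * n) ^ d := by
    have h1 := ((sum_enorm_sub_le_sum_localSum hco φ S fun x hx => hSC hx).trans
      (Finset.sum_le_sum_of_subset hS)).trans (hsum L)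
    have h2 : ENNReal.ofReal (∑ p ∈ (S ×ˢ S).filter fun p => (openGraph ω).Adj p.1 p.2,
        |(χ ω p.1 - φ (shift p.1 ω)) - (χ ω p.2 - φ (shift p.2 ω))|) ≤
          ENNReal.ofReal (q * (2 * L + 1) ^ d) := by
      rw [ENNReal.ofReal_sum_of_nonneg fun p _ => abs_nonneg _, ENNReal.ofReal_mul hq,
        ENNReal.ofReal_pow (by positivity)]
      simp only [← Real.enorm_eq_ofReal_abs]
      refine h1.trans_eq ?_
      congr 2
      rw [ENNReal.ofReal_add (by positivity) zero_le_one, ENNReal.ofReal_mul zero_le_two]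
      simp
    refine ((ENNReal.ofReal_le_ofReal_iff (by positivity)).1 h2).trans ?_
    have hLle : (L : ℝ) ≤ CW * n := Nat.floor_le (by positivity)
    have : 1 ≤ CW * n := by nlinarith
    gcongr
    linarith
  have hsub : ∑ x ∈ (finite_ball ω 0 n).toFinset, |χ ω x - φ (shift x ω) - m| ≤
      ∑ x ∈ S, |χ ω x - φ (shift x ω) - m| :=
    Finset.sum_le_sum_of_subset_of_nonneg
      (fun x hx => hBS ((Set.Finite.mem_toFinset _).1 hx)) fun _ _ _ => abs_nonneg _
  calc Criso * ∑ x ∈ (finite_ball ω 0 n).toFinset, |χ ω x - φ (shift x ω) - m|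
      ≤ Criso * ∑ x ∈ S, |χ ω x - φ (shift x ω) - m| := by gcongr
    _ = n * (Criso * (n : ℝ)⁻¹ * ∑ x ∈ S, |χ ω x - φ (shift x ω) - m|) := by field_simp
    _ ≤ n * (q * (3 * CW * n) ^ d) := by
        exact mul_le_mul_of_nonneg_left (hm.trans hgrad) hn0.le

/-- As $\theta/d\le1$, the radius `r = n` at the centre 0 is among the admissible ones. -/
theorem IsVeryRegularBall.isRegularBall {CV Criso CW θ : ℝ} (hd : 1 ≤ d) (hθ1 : θ < 1)
    {ω : Env d} (h0 : 0 ∈ cluster ω) {n : ℕ} (hn : 1 ≤ n)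
    (h : IsVeryRegularBall CV Criso CW θ ω n) : IsRegularBall CV Criso CW ω 0 n := by
  refine h 0 ⟨h0, by simp⟩ n hn ?_
  have hd' : (1 : ℝ) ≤ d := by exact_mod_cast hd
  calc (n : ℝ) ^ (θ / d) ≤ (n : ℝ) ^ (1 : ℝ) := by
        refine Real.rpow_le_rpow_of_exponent_le (by exact_mod_cast hn) ?_
        rw [div_le_one (by linarith)]
        linarith
    _ = n := Real.rpow_one _

theorem monotone_ball (ω : Env d) (x : Fin d → ℤ) :
    Monotone fun n : ℕ => (finite_ball ω x n).toFinset := by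
  intro n m h
  simp only [Set.Finite.toFinset_subset_toFinset]
  rintro y ⟨hy, hd⟩
  refine ⟨hy, hd.trans ?_⟩
  rw [Nat.floor_natCast, Nat.floor_natCast]
  exact_mod_cast h

/-- `ℓ¹`-sublinearity of potential fields. -/
theorem MemLpot.ae_tendsto_average {P : Measure (Env d)} [IsProbabilityMeasure P]
    (hP : IsAdmissibleLaw P) {CV Criso CW : ℝ} (hCV : 0 < CV) (hCriso : 0 < Criso) (hCW : 1 ≤ CW)
    (hreg : ∀ᵐ ω ∂(condLaw P), ∃ N₀ : ℕ, ∀ n : ℕ, N₀ ≤ n → IsRegularBall CV Criso CW ω 0 n)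
    (hinv : ∀ e : Edge d,
      ∫⁻ ω, (if 0 < ω e then (((ω e)⁻¹ : ℝ≥0) : ℝ≥0∞) else 0) ∂P < ∞)
    {χ : Env d → (Fin d → ℤ) → ℝ} (hχ : MemLpot P χ) :
    ∀ᵐ ω ∂(condLaw P),
      Tendsto (fun n : ℕ => 1 / ((ball ω 0 n).ncard : ℝ) *
          ∑ x ∈ (finite_ball ω 0 n).toFinset, |1 / (n : ℝ) * χ ω x|)
        atTop (𝓝 0) := by
  have hex : ∀ k : ℕ, ∃ φ : Env d → ℝ, IsLocal φ ∧
      ∫⁻ ω, localSum (fun ω x => χ ω x - grad φ ω x) ω ∂P ≤ (4⁻¹ : ℝ≥0∞) ^ k := fun k =>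
    exists_isLocal_lintegral_localSum_le hinv hχ (by simp) (ENNReal.pow_ne_top (by simp))
  choose φ hφ hφk using hex
  have hmax := hP.ae_eventually_sum_cube_le
    (fun k => measurable_localSum fun x => (hχ.1.measurable x).sub
      (measurable_grad (hφ k).measurable x)) hφk
  have hmax' : ∀ᵐ ω ∂condLaw P, _ := ae_condLaw_iff.2 (hmax.mono fun _ h _ => h)
  filter_upwards [hmax', hreg, hχ.1.cocycle] with ω hω ⟨N₀, hN₀⟩ hco
  have hcardlow : ∀ n, N₀ ≤ n → CV * (n : ℝ) ^ d ≤ (finite_ball ω 0 (n : ℝ)).toFinset.card := by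
    intro n hn
    rw [card_ball_eq_ncard]
    exact (hN₀ n hn).1
  simp only [← card_ball_eq_ncard]
  refine tendsto_average_of_oscillation (fun n : ℕ => (finite_ball ω 0 (n : ℝ)).toFinset)
    (monotone_ball ω 0) (χ ω) (9 ^ d / CV) ?_ ?_ ?_
  · filter_upwards [eventually_ge_atTop N₀, eventually_gt_atTop 0] with n hn hn0
    have h := hcardlow n hn
    have hpos : (0 : ℝ) < CV * (n : ℝ) ^ d := by positivity
    rw [← Finset.card_pos]
    exact_mod_cast hpos.trans_le h
  -- Doubling: the upper bound comes from the surrounding cube, the lower one from volume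
  -- regularity, and $2n+1\le9\lfloor n/2\rfloor$ for $n\ge2$.
  · filter_upwards [eventually_ge_atTop (2 * N₀), eventually_ge_atTop 2] with n hn hn2
    have h1 := hcardlow (n / 2) (by omega)
    have h2 : ((finite_ball ω 0 (n : ℝ)).toFinset.card : ℝ) ≤ (9 * (n / 2 : ℕ)) ^ d := by
      have : (finite_ball ω 0 (n : ℝ)).toFinset.card ≤ (9 * (n / 2)) ^ d :=
        (card_ball_le ω n).trans (Nat.pow_le_pow_left (by omega) _)
      exact_mod_cast this
    calc ((finite_ball ω 0 (n : ℝ)).toFinset.card : ℝ) ≤ (9 * (n / 2 : ℕ)) ^ d := h2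
      _ = 9 ^ d / CV * (CV * ((n / 2 : ℕ) : ℝ) ^ d) := by rw [mul_pow]; field_simp
      _ ≤ _ := by gcongr
  · intro ε hε
    -- Collects the Poincaré and volume constants. The index `k` is fixed first, with
    -- $D2^{-k}<\varepsilon/2$; only then is `n` taken large, depending on the bound `M` of `φ k`.
    set D := (3 * CW) ^ d / (Criso * CV) with hD
    have hD0 : 0 < D := by positivity
    have hlim : Tendsto (fun k : ℕ => D * (2⁻¹ : ℝ) ^ k) atTop (𝓝 (D * 0)) :=
      (tendsto_pow_atTop_nhds_zero_of_lt_one (by norm_num) (by norm_num)).const_mul D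
    rw [mul_zero] at hlim
    obtain ⟨k, hk, hkD⟩ := (hω.and (hlim.eventually_lt_const (half_pos hε))).exists
    obtain ⟨M, hM⟩ := (hφ k).bounded
    have hlarge : ∀ᶠ n : ℕ in atTop, M ≤ ε / 2 * n := by
      have : Tendsto (fun n : ℕ => ε / 2 * (n : ℝ)) atTop atTop :=
        tendsto_natCast_atTop_atTop.const_mul_atTop (half_pos hε)
      exact this.eventually_ge_atTop M
    filter_upwards [eventually_ge_atTop N₀, eventually_ge_atTop 1, hlarge] with n hn hn1 hnM
    obtain ⟨m, hm⟩ := (hN₀ n hn).exists_sum_abs_sub_le hCriso hCW hn1 hco (φ k)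
      (q := (2⁻¹ : ℝ) ^ k) (by positivity) (by
        intro L
        refine (hk L).trans_eq ?_
        rw [ENNReal.ofReal_pow (by norm_num), ENNReal.ofReal_inv_of_pos (by norm_num)]
        simp)
    refine ⟨m, ?_⟩
    set B := (finite_ball ω 0 (n : ℝ)).toFinset with hB
    have hcard := hcardlow n hn
    have h1 : ∑ x ∈ B, |χ ω x - φ k (shift x ω) - m| ≤ n * (ε / 2) * B.card := by
      have : Criso * ∑ x ∈ B, |χ ω x - φ k (shift x ω) - m| ≤
          Criso * (n * (ε / 2) * B.card) := by
        calc _ ≤ n * ((2⁻¹ : ℝ) ^ k * (3 * CW * n) ^ d) := hm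
          _ = Criso * (n * (D * (2⁻¹ : ℝ) ^ k) * (CV * (n : ℝ) ^ d)) := by
              rw [hD, mul_pow (3 * CW)]; field_simp
          _ ≤ Criso * (n * (ε / 2) * B.card) := by gcongr
      exact le_of_mul_le_mul_left this hCriso
    calc ∑ x ∈ B, |χ ω x - m| ≤ ∑ x ∈ B, (|χ ω x - φ k (shift x ω) - m| + ε / 2 * n) := by
          refine Finset.sum_le_sum fun x _ => ?_
          have h2 := abs_add_le (χ ω x - φ k (shift x ω) - m) (φ k (shift x ω))
          have h3 := hM (shift x ω)
          rw [show χ ω x - φ k (shift x ω) - m + φ k (shift x ω) = χ ω x - m by ring] at h2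
          linarith
      _ ≤ n * (ε / 2) * B.card + B.card * (ε / 2 * n) := by
          rw [Finset.sum_add_distrib, Finset.sum_const, nsmul_eq_mul]
          gcongr
      _ = ε * n * B.card := by ring

/-! ### The Hilbert space of fields on the edges at the origin -/

/-- The measure on `Ω × ℤ^d` whose `L²`-norm is the norm of `L²_cov`. -/
noncomputable def edgeMeasure (P : Measure (Env d)) : Measure (Env d × (Fin d → ℤ)) :=
  ∑ e ∈ unitSteps d, ((condLaw P).withDensity fun ω => (conductance ω 0 e : ℝ≥0∞)).map
    fun ω => (ω, e)

theorem measurable_uncurry_field {β : Type*} [MeasurableSpace β]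
    {Ψ : Env d → (Fin d → ℤ) → β} (hΨ : ∀ x, Measurable fun ω => Ψ ω x) :
    Measurable fun p : Env d × (Fin d → ℤ) => Ψ p.1 p.2 :=
  measurable_from_prod_countable_left hΨ

theorem measurable_mk_edge (e : Fin d → ℤ) : Measurable fun ω : Env d => (ω, e) :=
  measurable_id.prodMk measurable_const

theorem lintegral_edgeMeasure (P : Measure (Env d)) {F : Env d × (Fin d → ℤ) → ℝ≥0∞}
    (hF : Measurable F) : ∫⁻ p, F p ∂edgeMeasure P =
      ∫⁻ ω, ∑ e ∈ unitSteps d, (conductance ω 0 e : ℝ≥0∞) * F (ω, e) ∂condLaw P := by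
  have hm : ∀ e : Fin d → ℤ, Measurable fun ω : Env d => F (ω, e) :=
    fun e => hF.comp (measurable_mk_edge e)
  have hm' : ∀ e : Fin d → ℤ, Measurable fun ω : Env d => (conductance ω 0 e : ℝ≥0∞) * F (ω, e) :=
    fun e => (measurable_conductance 0 e).coe_nnreal_ennreal.mul (hm e)
  rw [edgeMeasure, lintegral_finsetSum_measure, lintegral_finsetSum _ fun e _ => hm' e]
  refine Finset.sum_congr rfl fun e _ => ?_
  rw [lintegral_map hF (measurable_mk_edge e), lintegral_withDensity_eq_lintegral_mul _
    (measurable_conductance 0 e).coe_nnreal_ennreal (hm e)]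
  rfl

theorem integral_edgeMeasure {P : Measure (Env d)} {F : Env d × (Fin d → ℤ) → ℝ}
    (hF : Measurable F) (hint : Integrable F (edgeMeasure P)) : ∫ p, F p ∂edgeMeasure P =
      ∫ ω, ∑ e ∈ unitSteps d, (conductance ω 0 e : ℝ) * F (ω, e) ∂condLaw P := by
  have hint' := integrable_finsetSum_measure.1 hint
  have hsmul : ∀ e ∈ unitSteps d, Integrable
      (fun ω => (conductance ω 0 e : ℝ) * F (ω, e)) (condLaw P) := by
    intro e he
    have h := (integrable_map_measure hF.aestronglyMeasurable
      (measurable_mk_edge e).aemeasurable).1 (hint' e he)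
    exact (integrable_withDensity_iff_integrable_smul (measurable_conductance 0 e)).1 h
  rw [edgeMeasure, integral_finsetSum_measure hint', integral_finsetSum _ hsmul]
  refine Finset.sum_congr rfl fun e _ => ?_
  rw [integral_map (measurable_mk_edge e).aemeasurable hF.aestronglyMeasurable,
    integral_withDensity_eq_integral_smul (measurable_conductance 0 e)]
  rfl

theorem covNormSq_eq (P : Measure (Env d)) {Ψ : Env d → (Fin d → ℤ) → ℝ}
    (hΨ : ∀ x, Measurable fun ω => Ψ ω x) :
    covNormSq P Ψ = eLpNorm (fun p : Env d × (Fin d → ℤ) => Ψ p.1 p.2) 2 (edgeMeasure P) ^ 2 := by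
  have h := eLpNorm_nnreal_pow_eq_lintegral (μ := edgeMeasure P) (p := 2)
    (f := fun p : Env d × (Fin d → ℤ) => Ψ p.1 p.2) two_ne_zero
  simp only [NNReal.coe_ofNat, ENNReal.rpow_ofNat, ENNReal.coe_ofNat] at h
  rw [h, lintegral_edgeMeasure P ((measurable_uncurry_field hΨ).enorm.pow_const 2)]
  rfl

theorem memLp_of_covNormSq_lt_top {P : Measure (Env d)} {Ψ : Env d → (Fin d → ℤ) → ℝ}
    (hΨ : ∀ x, Measurable fun ω => Ψ ω x) (h : covNormSq P Ψ < ∞) :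
    MemLp (fun p : Env d × (Fin d → ℤ) => Ψ p.1 p.2) 2 (edgeMeasure P) := by
  refine ⟨(measurable_uncurry_field hΨ).aestronglyMeasurable, ?_⟩
  rw [covNormSq_eq P hΨ] at h
  by_contra! htop
  rw [top_le_iff.1 htop] at h
  simp at h

theorem MemLcov.memLp {P : Measure (Env d)} {Ψ : Env d → (Fin d → ℤ) → ℝ} (h : MemLcov P Ψ) :
    MemLp (fun p : Env d × (Fin d → ℤ) => Ψ p.1 p.2) 2 (edgeMeasure P) :=
  memLp_of_covNormSq_lt_top h.measurable h.normSq_lt_top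

theorem lintegral_conductance_condLaw_lt_top {P : Measure (Env d)} [IsProbabilityMeasure P]
    (hP : IsAdmissibleLaw P) {e : Fin d → ℤ} (he : e ∈ unitSteps d) :
    ∫⁻ ω, (conductance ω 0 e : ℝ≥0∞) ∂condLaw P < ∞ := by
  rw [lintegral_condLaw]
  refine ENNReal.mul_lt_top (ENNReal.inv_lt_top.2 hP.pos) ?_
  refine (setLIntegral_le_lintegral _ _).trans_lt ?_
  simp only [conductance, dif_pos (mem_unitSteps.1 he)]
  exact hP.integrable _

theorem covNormSq_lt_top_of_bounded {P : Measure (Env d)} [IsProbabilityMeasure P]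
    (hP : IsAdmissibleLaw P) {Ψ : Env d → (Fin d → ℤ) → ℝ} {C : ℝ}
    (hC : ∀ ω, ∀ e ∈ unitSteps d, |Ψ ω e| ≤ C) : covNormSq P Ψ < ∞ := by
  have hle : covNormSq P Ψ ≤ ∫⁻ ω, ∑ x ∈ unitSteps d,
      (conductance ω 0 x : ℝ≥0∞) * ENNReal.ofReal C ^ 2 ∂condLaw P := by
    refine lintegral_mono fun ω => Finset.sum_le_sum fun e he => ?_
    gcongr
    rw [Real.enorm_eq_ofReal_abs]
    exact ENNReal.ofReal_le_ofReal (hC ω e he)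
  refine hle.trans_lt ?_
  rw [lintegral_finsetSum _ fun e _ =>
    (measurable_conductance 0 e).coe_nnreal_ennreal.mul_const _]
  refine ENNReal.sum_lt_top.2 fun e he => ?_
  rw [lintegral_mul_const _ (measurable_conductance 0 e).coe_nnreal_ennreal]
  exact ENNReal.mul_lt_top (lintegral_conductance_condLaw_lt_top hP he)
    (ENNReal.pow_lt_top ENNReal.ofReal_lt_top)

theorem covNormSq_grad_lt_top {P : Measure (Env d)} [IsProbabilityMeasure P]
    (hP : IsAdmissibleLaw P) {φ : Env d → ℝ} (hφ : IsLocal φ) : covNormSq P (grad φ) < ∞ := by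
  obtain ⟨C, hC⟩ := hφ.bounded
  exact covNormSq_lt_top_of_bounded hP (C := C + C) fun ω e _ =>
    (abs_sub _ _).trans (add_le_add (hC _) (hC _))

theorem IsLocal.zero : IsLocal (fun _ : Env d => (0 : ℝ)) :=
  ⟨measurable_const, ⟨0, by simp⟩, ⟨∅, fun _ _ _ => rfl⟩⟩

theorem IsLocal.add {φ ψ : Env d → ℝ} (hφ : IsLocal φ) (hψ : IsLocal ψ) :
    IsLocal fun ω => φ ω + ψ ω := by
  classical
  obtain ⟨C, hC⟩ := hφ.bounded
  obtain ⟨D, hD⟩ := hψ.bounded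
  obtain ⟨F, hF⟩ := hφ.dependsOn
  obtain ⟨G, hG⟩ := hψ.dependsOn
  refine ⟨hφ.measurable.add hψ.measurable, ⟨C + D, fun ω =>
    (abs_add_le _ _).trans (add_le_add (hC ω) (hD ω))⟩, ⟨F ∪ G, fun x y h => ?_⟩⟩
  show φ x + ψ x = φ y + ψ y
  rw [hF fun i hi => h i (by simp_all), hG fun i hi => h i (by simp_all)]

theorem IsLocal.const_mul {φ : Env d → ℝ} (hφ : IsLocal φ) (c : ℝ) :
    IsLocal fun ω => c * φ ω := by
  obtain ⟨C, hC⟩ := hφ.bounded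
  obtain ⟨F, hF⟩ := hφ.dependsOn
  refine ⟨hφ.measurable.const_mul c, ⟨|c| * C, fun ω => ?_⟩, ⟨F, fun x y h => ?_⟩⟩
  · rw [abs_mul]
    exact mul_le_mul_of_nonneg_left (hC ω) (abs_nonneg c)
  · show c * φ x = c * φ y
    rw [hF h]

/-- The gradients of local functions, as a subspace of the Hilbert space of square integrable
fields. -/
noncomputable def gradSubmodule (P : Measure (Env d)) :
    Submodule ℝ (Lp ℝ 2 (edgeMeasure P)) where
  carrier := {f | ∃ φ : Env d → ℝ, IsLocal φ ∧ f =ᵐ[edgeMeasure P] fun p => grad φ p.1 p.2}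
  zero_mem' := ⟨_, IsLocal.zero, by
    filter_upwards [Lp.coeFn_zero ℝ 2 (edgeMeasure P)] with p hp
    rw [hp]; simp [grad]⟩
  add_mem' := by
    rintro f g ⟨φ, hφ, hf⟩ ⟨ψ, hψ, hg⟩
    refine ⟨_, hφ.add hψ, ?_⟩
    filter_upwards [Lp.coeFn_add f g, hf, hg] with p hp h1 h2
    rw [hp, Pi.add_apply, h1, h2]
    simp only [grad]
    ring
  smul_mem' := by
    rintro c f ⟨φ, hφ, hf⟩
    refine ⟨_, hφ.const_mul c, ?_⟩
    filter_upwards [Lp.coeFn_smul c f, hf] with p hp h1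
    rw [hp, Pi.smul_apply, h1, smul_eq_mul]
    simp only [grad]
    ring

theorem covNormSq_sub_eq (P : Measure (Env d)) {Ψ Φ : Env d → (Fin d → ℤ) → ℝ}
    (hΨ : ∀ x, Measurable fun ω => Ψ ω x) (hΦ : ∀ x, Measurable fun ω => Φ ω x) :
    covNormSq P (fun ω x => Ψ ω x - Φ ω x) =
      eLpNorm ((fun p : Env d × (Fin d → ℤ) => Ψ p.1 p.2) - fun p => Φ p.1 p.2) 2
        (edgeMeasure P) ^ 2 :=
  covNormSq_eq P fun x => (hΨ x).sub (hΦ x)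

/-- `covNormSq` is a squared $L^2$ norm, so the approximation is requested at precision `ε ^ 2`. -/
theorem MemLpot.toLp_mem {P : Measure (Env d)} [IsProbabilityMeasure P] (hP : IsAdmissibleLaw P)
    {Ψ : Env d → (Fin d → ℤ) → ℝ} (h : MemLpot P Ψ) :
    h.1.memLp.toLp _ ∈ (gradSubmodule P).topologicalClosure := by
  rw [← SetLike.mem_coe, Submodule.topologicalClosure_coe, EMetric.mem_closure_iff]
  intro ε hε
  obtain ⟨φ, hφ, hlt⟩ := h.2 (ε ^ 2) (ENNReal.pow_pos hε 2)
  have hg := memLp_of_covNormSq_lt_top (measurable_grad hφ.measurable)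
    (covNormSq_grad_lt_top hP hφ)
  refine ⟨hg.toLp _, ⟨φ, hφ, hg.coeFn_toLp⟩, ?_⟩
  rw [Lp.edist_toLp_toLp]
  rw [covNormSq_sub_eq P h.1.measurable (measurable_grad hφ.measurable)] at hlt
  exact lt_of_pow_lt_pow_left' 2 hlt

/-! ### Cocycle representatives -/

theorem exists_tendsto_sub_of_reachable {ω : Env d} {φ : ℕ → Env d → ℝ}
    (h : ∀ x ∈ cluster ω, ∀ y, (openGraph ω).Adj x y →
      ∃ l, Tendsto (fun k => φ k (shift y ω) - φ k (shift x ω)) atTop (𝓝 l))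
    {x y : cluster ω} (hxy : ((openGraph ω).induce (cluster ω)).Reachable x y) :
    ∃ l, Tendsto (fun k => φ k (shift y ω) - φ k (shift x ω)) atTop (𝓝 l) := by
  obtain ⟨p⟩ := hxy
  induction p with
  | nil => exact ⟨0, by simp⟩
  | @cons u v w hadj _ ih =>
    obtain ⟨l, hl⟩ := ih
    obtain ⟨l', hl'⟩ := h u u.2 v hadj
    exact ⟨l + l', (hl.add hl').congr fun k => by ring⟩

/-- The density of `edgeMeasure` is positive on open edges, so convergence holds $\mathbb P_0$-a.s.
on those at the origin. Stationarity moves it to every vertex of the cluster, and increments add up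
along connecting paths. -/
theorem IsAdmissibleLaw.ae_exists_tendsto {P : Measure (Env d)} [IsProbabilityMeasure P]
    (hP : IsAdmissibleLaw P) {φ : ℕ → Env d → ℝ}
    (h : ∀ᵐ p ∂edgeMeasure P, ∃ l, Tendsto (fun k => grad (φ k) p.1 p.2) atTop (𝓝 l)) :
    ∀ᵐ ω ∂P, ∀ x ∈ cluster ω, ∀ y ∈ cluster ω,
      ∃ l, Tendsto (fun k => φ k (shift y ω) - φ k (shift x ω)) atTop (𝓝 l) := by
  have h0 : ∀ᵐ ω ∂condLaw P, ∀ e ∈ unitSteps d, (openGraph ω).Adj 0 e →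
      ∃ l, Tendsto (fun k => grad (φ k) ω e) atTop (𝓝 l) := by
    rw [edgeMeasure, ae_finsetSum_measure_iff] at h
    refine (ae_ball_iff (Finset.countable_toSet _)).2 fun e he => ?_
    have h1 := ae_of_ae_map (measurable_mk_edge e).aemeasurable (h e he)
    rw [ae_withDensity_iff (measurable_conductance 0 e).coe_nnreal_ennreal] at h1
    filter_upwards [h1] with ω hω hadj
    have hadj' : 0 < conductance ω 0 e := hadj
    exact hω (by exact_mod_cast hadj'.ne')
  filter_upwards [hP.ae_forall_cluster h0, hP.connected] with ω hω hconn x hx y hy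
  refine exists_tendsto_sub_of_reachable (x := ⟨x, hx⟩) (y := ⟨y, hy⟩) (fun u hu v huv => ?_)
    (hconn.preconnected _ _)
  obtain ⟨l, hl⟩ := hω u hu (v - u) (sub_mem_unitSteps huv)
    (openGraph_adj_shift.2 (by simpa using huv))
  refine ⟨l, ?_⟩
  simpa only [grad, shift_shift, add_sub_cancel] using hl

theorem exists_memLpot_ae_eq {P : Measure (Env d)} [IsProbabilityMeasure P]
    (hP : IsAdmissibleLaw P) {f : Lp ℝ 2 (edgeMeasure P)}
    (hf : f ∈ (gradSubmodule P).topologicalClosure) :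
    ∃ Ψ, MemLpot P Ψ ∧ f =ᵐ[edgeMeasure P] fun p => Ψ p.1 p.2 := by
  rw [← SetLike.mem_coe, Submodule.topologicalClosure_coe, mem_closure_iff_seq_limit] at hf
  obtain ⟨g, hg, hlim⟩ := hf
  choose φ hφ hgφ using hg
  obtain ⟨ns, -, hns⟩ := (tendstoInMeasure_of_tendsto_Lp hlim).exists_seq_tendsto_ae
  have hae : ∀ᵐ p ∂edgeMeasure P,
      Tendsto (fun k => grad (φ (ns k)) p.1 p.2) atTop (𝓝 (f p)) := by
    filter_upwards [hns, ae_all_iff.2 hgφ] with p hp hp'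
    exact hp.congr fun k => hp' (ns k)
  -- The upper limit is measurable with no convergence assumption, and is a genuine limit at cluster
  -- points when the origin is in the cluster; there the cocycle identity passes to the limit.
  set Ψ : Env d → (Fin d → ℤ) → ℝ := fun ω x =>
    limsup (fun k => grad (φ (ns k)) ω x) atTop with hΨ
  have hΨm : ∀ x, Measurable fun ω => Ψ ω x := fun x =>
    Measurable.limsup fun k => measurable_grad (hφ (ns k)).measurable x
  have hfΨ : f =ᵐ[edgeMeasure P] fun p => Ψ p.1 p.2 := by
    filter_upwards [hae] with p hp
    exact hp.limsup_eq.symm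
  have hco : ∀ᵐ ω ∂condLaw P, ∀ x ∈ cluster ω, ∀ y ∈ cluster ω,
      Ψ (shift x ω) (y - x) = Ψ ω y - Ψ ω x := by
    rw [ae_condLaw_iff]
    filter_upwards [hP.ae_exists_tendsto (hae.mono fun p hp => ⟨_, hp⟩)] with ω hω h0 x hx y hy
    obtain ⟨a, ha⟩ := hω 0 h0 x hx
    obtain ⟨b, hb⟩ := hω 0 h0 y hy
    simp only [shift_zero] at ha hb
    have hxy : Tendsto (fun k => grad (φ (ns k)) (shift x ω) (y - x)) atTop (𝓝 (b - a)) := by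
      simp only [grad, shift_shift, add_sub_cancel]
      exact (hb.sub ha).congr fun k => by ring
    exact hxy.limsup_eq.trans (congrArg₂ (· - ·) hb.limsup_eq ha.limsup_eq).symm
  have hnorm : covNormSq P Ψ < ∞ := by
    rw [covNormSq_eq P hΨm, ← eLpNorm_congr_ae hfΨ]
    exact ENNReal.pow_lt_top (Lp.eLpNorm_lt_top f)
  refine ⟨Ψ, ⟨⟨hΨm, hco, hnorm⟩, fun ε hε => ?_⟩, hfΨ⟩
  have hedist : Tendsto (fun k => edist f (g k) ^ 2) atTop (𝓝 0) := by
    have h1 : Tendsto (fun k => edist f (g k)) atTop (𝓝 0) := by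
      simpa only [edist_comm f] using (tendsto_iff_edist_tendsto_0.1 hlim)
    simpa using ENNReal.Tendsto.pow (n := 2) h1
  obtain ⟨k, hk⟩ := (hedist.eventually_lt_const hε).exists
  refine ⟨φ k, hφ k, ?_⟩
  rw [covNormSq_sub_eq P hΨm (measurable_grad (hφ k).measurable)]
  rw [Lp.edist_def] at hk
  rwa [← eLpNorm_congr_ae (hfΨ.sub (hgφ k))]

/-! ### Existence of the corrector -/

theorem memLcov_position {P : Measure (Env d)} [IsProbabilityMeasure P] (hP : IsAdmissibleLaw P)
    (j : Fin d) : MemLcov P fun _ x => (x j : ℝ) := by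
  refine ⟨fun x => measurable_const, ae_of_all _ fun ω x _ y _ => by simp,
    covNormSq_lt_top_of_bounded hP (C := 1) fun _ e he => ?_⟩
  have h := mem_unitSteps.1 he
  have h1 : |(0 : Fin d → ℤ) j - e j| ≤ ∑ i, |(0 : Fin d → ℤ) i - e i| :=
    Finset.single_le_sum (f := fun i => |(0 : Fin d → ℤ) i - e i|) (fun i _ => abs_nonneg _)
      (Finset.mem_univ j)
  have h2 : |e j| ≤ 1 := by
    have h3 : ∑ i, |(0 : Fin d → ℤ) i - e i| = 1 := h
    rw [h3] at h1
    simpa using h1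
  exact_mod_cast h2

theorem MemLcov.sub {P : Measure (Env d)} {Ψ Φ : Env d → (Fin d → ℤ) → ℝ}
    (hΨ : MemLcov P Ψ) (hΦ : MemLcov P Φ) : MemLcov P fun ω x => Ψ ω x - Φ ω x := by
  have hm : ∀ x, Measurable fun ω => Ψ ω x - Φ ω x :=
    fun x => (hΨ.measurable x).sub (hΦ.measurable x)
  refine ⟨hm, ?_, ?_⟩
  · filter_upwards [hΨ.cocycle, hΦ.cocycle] with ω h1 h2 x hx y hy
    rw [h1 x hx y hy, h2 x hx y hy]
    ring
  · rw [covNormSq_eq P hm]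
    exact ENNReal.pow_lt_top (hΨ.memLp.sub hΦ.memLp).2

theorem covInner_eq_inner {P : Measure (Env d)} {Ψ Φ : Env d → (Fin d → ℤ) → ℝ}
    (hΨ : MemLcov P Ψ) (hΦ : MemLcov P Φ) :
    covInner P Ψ Φ = inner ℝ (hΨ.memLp.toLp _) (hΦ.memLp.toLp _) := by
  have hint : Integrable (fun p : Env d × (Fin d → ℤ) => Ψ p.1 p.2 * Φ p.1 p.2)
      (edgeMeasure P) := hΨ.memLp.integrable_mul hΦ.memLp
  have hm : Measurable fun p : Env d × (Fin d → ℤ) => Ψ p.1 p.2 * Φ p.1 p.2 :=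
    (measurable_uncurry_field hΨ.measurable).mul (measurable_uncurry_field hΦ.measurable)
  rw [L2.inner_def, covInner, ← integral_edgeMeasure hm hint]
  refine integral_congr_ae ?_
  filter_upwards [hΨ.memLp.coeFn_toLp, hΦ.memLp.coeFn_toLp] with p h1 h2
  rw [h1, h2, real_inner_comm]
  rfl

/-- $\chi_j$ is a cocycle version of the projection of $\Pi_j$ onto the closed span of gradients.
The residual is orthogonal to that space, which contains the class of every field in
$L^2_{\mathrm{pot}}$. -/
theorem exists_isCorrector {P : Measure (Env d)} [IsProbabilityMeasure P]
    (hP : IsAdmissibleLaw P) (j : Fin d) :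
    ∃ χ : Env d → (Fin d → ℤ) → ℝ, IsCorrector P j χ := by
  set K := (gradSubmodule P).topologicalClosure with hK
  have : CompleteSpace K := (gradSubmodule P).isClosed_topologicalClosure.completeSpace_coe
  have hpos := memLcov_position hP j
  set v := hpos.memLp.toLp _ with hv
  obtain ⟨χ, hχ, hχv⟩ := exists_memLpot_ae_eq hP (K.starProjection_apply_mem v)
  refine ⟨χ, hχ, hpos.sub hχ.1, fun Ψ hΨ => ?_⟩
  have heq : (hpos.sub hχ.1).memLp.toLp _ = v - K.starProjection v := by
    have h1 : K.starProjection v = hχ.1.memLp.toLp _ :=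
      Lp.ext (hχv.trans hχ.1.memLp.coeFn_toLp.symm)
    rw [h1, hv, ← MemLp.toLp_sub]
    rfl
  rw [covInner_eq_inner (hpos.sub hχ.1) hΨ.1, heq]
  exact Submodule.inner_left_of_mem_orthogonal (hΨ.toLp_mem hP)
    (Submodule.sub_starProjection_mem_orthogonal v)

end RandomConductance

open RandomConductance in
theorem mainTheorem3 (d : ℕ) (hd : 2 ≤ d)
    (P : Measure (Env d)) [IsProbabilityMeasure P] (hP : IsAdmissibleLaw P)
    (CV Criso CW : ℝ) (hCV : 0 < CV) (hCV1 : CV ≤ 1) (hCriso : 0 < Criso) (hCW : 1 ≤ CW)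
    (θ : ℝ) (hθ0 : 0 < θ) (hθ1 : θ < 1)
    (hreg : ∀ᵐ ω ∂(condLaw P), ∃ N₀ : ℕ, ∀ n : ℕ, N₀ ≤ n →
      IsVeryRegularBall CV Criso CW θ ω n)
    (hinv : ∀ e : Edge d,
      ∫⁻ ω, (if 0 < ω e then (((ω e)⁻¹ : ℝ≥0) : ℝ≥0∞) else 0) ∂P < ∞)
    (j : Fin d) :
    (∃ χ : Env d → (Fin d → ℤ) → ℝ, IsCorrector P j χ) ∧
    ∀ χ : Env d → (Fin d → ℤ) → ℝ, IsCorrector P j χ →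
      ∀ᵐ ω ∂(condLaw P),
        Tendsto (fun n : ℕ => 1 / ((ball ω 0 n).ncard : ℝ) *
            ∑ x ∈ (finite_ball ω 0 n).toFinset, |1 / (n : ℝ) * χ ω x|)
          atTop (𝓝 0) := by
  refine ⟨exists_isCorrector hP j, fun χ hχ => ?_⟩
  refine hχ.1.ae_tendsto_average hP hCV hCriso hCW ?_ hinv
  filter_upwards [hreg, ae_condLaw_iff.2 (ae_of_all P fun _ h => h)] with ω ⟨N₀, hN₀⟩ h0
  exact ⟨max N₀ 1, fun n hn => (hN₀ n (le_of_max_le_left hn)).isRegularBall (by omega) hθ1 h0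
    (le_of_max_le_right hn)⟩
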